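/- Let $M$ be a (Hausdorff, finite-dimensional) $C^\infty$ manifold, $\mathcal F$ a regular smooth foliation of $M$ with tangent bundle $T\mathcal F\subset TM$, and $T^*\mathcal F$ the dual bundle of $T\mathcal F$. For a smooth vector bundle morphism $N:T\mathcal F\to TM$ and $X,Y\in\Gamma(T\mathcal F)$ put $[X,Y]_N:=[NX,Y]+[X,NY]-N[X,Y]$, where $[\,,]$ is the commutator of vector fields. Assume that $(T\mathcal F,N)$ is a partial Nijenhuis operator (PNO), i.e. for all $X,Y\in\Gamma(T\mathcal F)$ one has $[X,Y]_N\in\Gamma(T\mathcal F)$ and $[NX,NY]=N[X,Y]_N$. For a Lie algebroid $(E,[\,,]_E,\rho)$ over $M$, the associated linear Poisson structure on the total space of $q:E^*\to M$ is the Poisson structure whose bracket satisfies $$\{\overline X,\overline Y\}=\overline{[X,Y]_E},\qquad \{\overline X,q^*f\}=q^*(\rho(X)f),\qquad \{q^*f,q^*g\}=0$$ for all $X,Y\in\Gamma(E)$, $f,g\in C^\infty(M)$, where $\overline X(\xi)=\langle\xi,X\rangle$. The canonical Poisson structure $\eta_{T^*M}$ on $T^*M$ is the one associated with the tangent Lie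 algebroid $(TM,[\,,],\mathrm{id})$. Then $(T\mathcal F,[\,,]_N,N)$ is a Lie algebroid; the associated linear Poisson structure $\eta_N$ on $T^*\mathcal F$ and the canonical Poisson structure $\eta_{T^*M}$ on $T^*M$ exist and are unique; the transposed map $N^t:T^*M\to T^*\mathcal F$ is smooth; and $$\eta_N=N^t_*\,\eta_{T^*M},$$ which means that for every $p\in T^*M$ the value of $\eta_N$ at $N^t(p)$ is the image of the bivector $\eta_{T^*M}(p)$ under the derivative of $N^t$ at $p$, i.e. for all covectors $\alpha,\beta$ of $T^*\mathcal F$ at $N^t(p)$ $$\eta_N|_{N^t(p)}(\alpha,\beta)=\eta_{T^*M}|_{p}\big(\alpha\circ d_pN^t,\ \beta\circ d_pN^t\big).$$ -/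

import Mathlib

open Bundle Set
open scoped Manifold ContDiff Topology

noncomputable section

set_option linter.unusedSectionVars false

lemma isManifold_minSmoothness (E : Type*) [NormedAddCommGroup E] [NormedSpace ℝ E]
    (M : Type*) [TopologicalSpace M] [ChartedSpace E M] [IsManifold 𝓘(ℝ, E) ∞ M] :
    IsManifold 𝓘(ℝ, E) (minSmoothness ℝ 2) M := by
  have hs : minSmoothness ℝ 2 = 2 := by simp
  rw [hs]; infer_instance

/-! ### Vector fields, sections and bundle morphisms to the tangent bundle -/

section Sections

variable (E : Type*) [NormedAddCommGroup E] [NormedSpace ℝ E]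
  (M : Type*) [TopologicalSpace M] [ChartedSpace E M]

/-- `Γ(TM)`, the smooth vector fields on `M`. -/
abbrev SmoothVectorField [IsManifold 𝓘(ℝ, E) ∞ M] : Type _ :=
  Cₛ^∞⟮𝓘(ℝ, E); E, (TangentSpace 𝓘(ℝ, E) : M → Type _)⟯

variable {M}
variable (F : Type*) [NormedAddCommGroup F] [NormedSpace ℝ F] (V : M → Type*)
  [TopologicalSpace (TotalSpace F V)] [∀ x, AddCommGroup (V x)] [∀ x, Module ℝ (V x)]
  [∀ x, TopologicalSpace (V x)] [FiberBundle F V] [VectorBundle ℝ F V]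

/-- The smooth vector bundle morphisms `V → TM` over the identity of `M`, that is, the smooth
sections of the bundle `Hom(V, TM)`. -/
abbrev HomToTangent [IsManifold 𝓘(ℝ, E) ∞ M] : Type _ :=
  Cₛ^∞⟮𝓘(ℝ, E); F →L[ℝ] E, fun x : M => V x →L[ℝ] TangentSpace 𝓘(ℝ, E) x⟯

/-- The total space of the dual bundle `V*`. -/
abbrev DualBundle : Type _ := TotalSpace (F →L[ℝ] ℝ) (fun x => V x →L[ℝ] ℝ)

variable {E F V} [IsManifold 𝓘(ℝ, E) ∞ M]

/-- The commutator of smooth vector fields. -/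
def lieBracketField [FiniteDimensional ℝ E] (X Y : SmoothVectorField E M) :
    SmoothVectorField E M where
  toFun := VectorField.mlieBracket 𝓘(ℝ, E) X Y
  contMDiff_toFun := by
    have : CompleteSpace E := FiniteDimensional.complete ℝ E
    have := isManifold_minSmoothness E M
    have : IsManifold 𝓘(ℝ, E) (((⊤ : ℕ∞) : WithTop ℕ∞) + 1) M := by simpa
    exact fun x => ContMDiffAt.mlieBracket_vectorField (m := ⊤) (n := ⊤) (X.contMDiff x)
      (Y.contMDiff x) (by simp)

/-- The derivative `X f` of the function `f` along the vector field `X`. -/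
def dirDeriv (X : SmoothVectorField E M) (f : C^∞⟮𝓘(ℝ, E), M; ℝ⟯) (x : M) : ℝ :=
  mfderiv 𝓘(ℝ, E) 𝓘(ℝ, ℝ) f x (X x)

/-- The map `Γ(V) → Γ(TM)` induced by a bundle morphism `V → TM`. -/
def HomToTangent.map (ρ : HomToTangent E F V) (X : Cₛ^∞⟮𝓘(ℝ, E); F, V⟯) :
    SmoothVectorField E M where
  toFun x := ρ x (X x)
  contMDiff_toFun := ρ.contMDiff.clm_bundle_apply X.contMDiff

/-- The product `f X` of a smooth function and a smooth section. -/
def funSMul (f : C^∞⟮𝓘(ℝ, E), M; ℝ⟯) (X : Cₛ^∞⟮𝓘(ℝ, E); F, V⟯) : Cₛ^∞⟮𝓘(ℝ, E); F, V⟯ where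
  toFun x := f x • X x
  contMDiff_toFun := f.contMDiff.smul_section X.contMDiff

/-- The identity morphism of `TM`, the anchor of the tangent Lie algebroid. -/
def tangentId : HomToTangent E E (TangentSpace 𝓘(ℝ, E) : M → Type _) where
  toFun x := ContinuousLinearMap.id ℝ (TangentSpace 𝓘(ℝ, E) x)
  contMDiff_toFun := by
    intro x
    rw [contMDiffAt_hom_bundle]
    refine ⟨contMDiffAt_id, ?_⟩
    have hc : ContMDiffAt 𝓘(ℝ, E) 𝓘(ℝ, E →L[ℝ] E) ∞
        (fun _ : M => ContinuousLinearMap.id ℝ E) x := contMDiffAt_const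
    refine hc.congr_of_eventuallyEq ?_
    filter_upwards [(trivializationAt E (TangentSpace 𝓘(ℝ, E)) x).open_baseSet.mem_nhds
      (FiberBundle.mem_baseSet_trivializationAt' x)] with y hy
    rw [ContinuousLinearMap.inCoordinates_eq hy hy]
    ext v
    exact ((trivializationAt E (TangentSpace 𝓘(ℝ, E) : M → Type _) x).continuousLinearEquivAt
      ℝ y hy).apply_symm_apply v

end Sections

/-! ### Lie algebroids -/

section Algebroid

variable {E : Type*} [NormedAddCommGroup E] [NormedSpace ℝ E] [FiniteDimensional ℝ E]
  {M : Type*} [TopologicalSpace M] [ChartedSpace E M] [IsManifold 𝓘(ℝ, E) ∞ M]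
  {F : Type*} [NormedAddCommGroup F] [NormedSpace ℝ F] {V : M → Type*}
  [TopologicalSpace (TotalSpace F V)] [∀ x, AddCommGroup (V x)] [∀ x, Module ℝ (V x)]
  [∀ x, TopologicalSpace (V x)] [FiberBundle F V] [VectorBundle ℝ F V]

/-- The vector bundle `V → M` with the bracket `br` on `Γ(V)` and the anchor `ρ : V → TM` is a
Lie algebroid. -/
structure IsLieAlgebroid (ρ : HomToTangent E F V)
    (br : Cₛ^∞⟮𝓘(ℝ, E); F, V⟯ → Cₛ^∞⟮𝓘(ℝ, E); F, V⟯ → Cₛ^∞⟮𝓘(ℝ, E); F, V⟯) : Prop where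
  add_left : ∀ X Y Z, br (X + Y) Z = br X Z + br Y Z
  add_right : ∀ X Y Z, br X (Y + Z) = br X Y + br X Z
  smul_left : ∀ (c : ℝ) (X Y), br (c • X) Y = c • br X Y
  smul_right : ∀ (c : ℝ) (X Y), br X (c • Y) = c • br X Y
  self : ∀ X, br X X = 0
  jacobi : ∀ X Y Z, br X (br Y Z) + br Y (br Z X) + br Z (br X Y) = 0
  anchor : ∀ X Y, ρ.map (br X Y) = lieBracketField (ρ.map X) (ρ.map Y)
  leibniz : ∀ X (f : C^∞⟮𝓘(ℝ, E), M; ℝ⟯) Y (x : M),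
    br X (funSMul f Y) x = f x • br X Y x + dirDeriv (ρ.map X) f x • Y x

end Algebroid

/-! ### Poisson structures -/

section Poisson

variable {E : Type*} [NormedAddCommGroup E] [NormedSpace ℝ E] {H : Type*} [TopologicalSpace H]
  (I : ModelWithCorners ℝ E H) (P : Type*) [TopologicalSpace P] [ChartedSpace H P]

variable {P} in
/-- The differential at `p` of a real function. -/
def differential (f : P → ℝ) (p : P) : TangentSpace I p →L[ℝ] ℝ := mfderiv I 𝓘(ℝ, ℝ) f p

/-- A smooth bivector field on `P`, as a field of alternating bilinear forms on the cotangent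
spaces; it is smooth when it sends pairs of differentials of smooth functions to smooth functions. -/
@[ext]
structure BivectorField where
  toFun : ∀ p : P, (TangentSpace I p →L[ℝ] ℝ) →ₗ[ℝ] (TangentSpace I p →L[ℝ] ℝ) →ₗ[ℝ] ℝ
  alternating : ∀ p α, toFun p α α = 0
  smooth : ∀ f g : C^∞⟮I, P; ℝ⟯,
    ContMDiff I 𝓘(ℝ, ℝ) ∞ (fun p => toFun p (differential I f p) (differential I g p))

variable {I P} in
/-- The bracket `{f, g} = η(df, dg)` on smooth functions. -/
def BivectorField.bracket (η : BivectorField I P) (f g : C^∞⟮I, P; ℝ⟯) : C^∞⟮I, P; ℝ⟯ :=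
  ⟨fun p => η.toFun p (differential I f p) (differential I g p), η.smooth f g⟩

/-- A Poisson structure: a bivector field whose bracket satisfies the Jacobi identity. -/
@[ext]
structure PoissonStructure extends BivectorField I P where
  jacobi : ∀ f g h : C^∞⟮I, P; ℝ⟯,
    toBivectorField.bracket f (toBivectorField.bracket g h) +
      toBivectorField.bracket g (toBivectorField.bracket h f) +
      toBivectorField.bracket h (toBivectorField.bracket f g) = 0

variable {I P} in
/-- `η' = φ_* η` for a smooth map `φ : P → Q`: at every point `φ p`, the bivector `η'` is the image
of the bivector `η_p` under the derivative of `φ` at `p`. -/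
def IsPushforward {E' : Type*} [NormedAddCommGroup E'] [NormedSpace ℝ E'] {H' : Type*}
    [TopologicalSpace H'] {I' : ModelWithCorners ℝ E' H'} {Q : Type*} [TopologicalSpace Q]
    [ChartedSpace H' Q] (φ : P → Q) (η : PoissonStructure I P) (η' : PoissonStructure I' Q) : Prop :=
  ∀ (p : P) (α β : TangentSpace I' (φ p) →L[ℝ] ℝ),
    η'.toFun (φ p) α β = η.toFun p (α ∘L mfderiv I I' φ p) (β ∘L mfderiv I I' φ p)

end Poisson

/-! ### The linear Poisson structure of a Lie algebroid -/

section LinearPoisson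

variable {E : Type*} [NormedAddCommGroup E] [NormedSpace ℝ E] [FiniteDimensional ℝ E]
  {M : Type*} [TopologicalSpace M] [ChartedSpace E M] [IsManifold 𝓘(ℝ, E) ∞ M]
  {F : Type*} [NormedAddCommGroup F] [NormedSpace ℝ F] {V : M → Type*}
  [TopologicalSpace (TotalSpace F V)] [∀ x, AddCommGroup (V x)] [∀ x, Module ℝ (V x)]
  [∀ x, TopologicalSpace (V x)] [FiberBundle F V] [VectorBundle ℝ F V]

/-- The fibrewise linear function `(x, ξ) ↦ ξ (X x)` on `V*` defined by a section `X` of `V`. -/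
def linearFun (X : Cₛ^∞⟮𝓘(ℝ, E); F, V⟯) :
    C^∞⟮𝓘(ℝ, E).prod 𝓘(ℝ, F →L[ℝ] ℝ), DualBundle F V; ℝ⟯ where
  val p := p.2 (X p.1)
  property := by
    have h1 : ContMDiff (𝓘(ℝ, E).prod 𝓘(ℝ, F →L[ℝ] ℝ)) (𝓘(ℝ, E).prod 𝓘(ℝ, F →L[ℝ] ℝ)) ∞
        (fun p : DualBundle F V => TotalSpace.mk' (F →L[ℝ] ℝ)
          (E := fun x => V x →L[ℝ] Bundle.Trivial M ℝ x) p.1 p.2) := contMDiff_id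
    have h2 : ContMDiff (𝓘(ℝ, E).prod 𝓘(ℝ, F →L[ℝ] ℝ)) (𝓘(ℝ, E).prod 𝓘(ℝ, F)) ∞
        (fun p : DualBundle F V => TotalSpace.mk' F (E := V) p.1 (X p.1)) :=
      X.contMDiff.comp (Bundle.contMDiff_proj _)
    have h3 := ContMDiff.clm_bundle_apply (E₂ := Bundle.Trivial M ℝ) (F₂ := ℝ) h1 h2
    intro p
    exact (Bundle.contMDiffAt_totalSpace.1 (h3 p)).2

/-- The base function `q* f`, where `q : V* → M` is the projection. -/
def baseFun (f : C^∞⟮𝓘(ℝ, E), M; ℝ⟯) :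
    C^∞⟮𝓘(ℝ, E).prod 𝓘(ℝ, F →L[ℝ] ℝ), DualBundle F V; ℝ⟯ :=
  ⟨fun p => f p.1, f.contMDiff.comp (Bundle.contMDiff_proj _)⟩

/-- `η` is the linear Poisson structure on `V*` associated with the Lie algebroid `(V, br, ρ)`. -/
structure IsLinearPoisson (ρ : HomToTangent E F V)
    (br : Cₛ^∞⟮𝓘(ℝ, E); F, V⟯ → Cₛ^∞⟮𝓘(ℝ, E); F, V⟯ → Cₛ^∞⟮𝓘(ℝ, E); F, V⟯)
    (η : PoissonStructure (𝓘(ℝ, E).prod 𝓘(ℝ, F →L[ℝ] ℝ)) (DualBundle F V)) : Prop where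
  linear_linear : ∀ X Y, η.bracket (linearFun X) (linearFun Y) = linearFun (br X Y)
  linear_base : ∀ X f (p : DualBundle F V),
    η.bracket (linearFun X) (baseFun f) p = dirDeriv (ρ.map X) f p.1
  base_base : ∀ f g, η.bracket (baseFun f) (baseFun g) = 0

/-- The transposed morphism `ρᵗ : T*M → V*` of `ρ : V → TM`, as a map of total spaces. -/
def HomToTangent.transpose (ρ : HomToTangent E F V)
    (p : DualBundle E (TangentSpace 𝓘(ℝ, E) : M → Type _)) : DualBundle F V :=
  ⟨p.1, p.2 ∘L ρ p.1⟩

/-- `η` is the canonical Poisson structure on `T*M`: the linear Poisson structure associated with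
the tangent Lie algebroid `(TM, [,], id)`. -/
def IsCanonicalPoisson (η : PoissonStructure (𝓘(ℝ, E).prod 𝓘(ℝ, E →L[ℝ] ℝ))
    (DualBundle E (TangentSpace 𝓘(ℝ, E) : M → Type _))) : Prop :=
  IsLinearPoisson tangentId lieBracketField η

end LinearPoisson

/-! ### Foliations and the vector bundle `T𝓕` -/

/-- A (regular, smooth) foliation of a manifold `M` modelled on `E`, recorded through the tangent
spaces to its leaves: around every point there is a chart of the smooth structure, with values
in `E`, in which the leaves are the translates of the fixed subspace `model` of `E`. -/
structure Foliation (E : Type*) [NormedAddCommGroup E] [NormedSpace ℝ E]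
    (M : Type*) [TopologicalSpace M] [ChartedSpace E M] where
  /-- the model of the leaves; its dimension is the rank of the foliation -/
  model : Submodule ℝ E
  /-- the tangent space at `x` to the leaf through `x` -/
  tangent : ∀ x : M, Submodule ℝ (TangentSpace 𝓘(ℝ, E) x)
  exists_flat_chart : ∀ x : M, ∃ φ ∈ IsManifold.maximalAtlas 𝓘(ℝ, E) ∞ M, x ∈ φ.source ∧
    ∀ y ∈ φ.source, ∀ v : TangentSpace 𝓘(ℝ, E) y,
      v ∈ tangent y ↔ (mfderiv 𝓘(ℝ, E) 𝓘(ℝ, E) φ y v : E) ∈ model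

namespace Foliation

section
variable {E : Type*} [NormedAddCommGroup E] [NormedSpace ℝ E] {M : Type*} [TopologicalSpace M]
  [ChartedSpace E M] [IsManifold 𝓘(ℝ, E) ∞ M]
variable {φ ψ : OpenPartialHomeomorph M E}

lemma mdifferentiable_of_mem (hφ : φ ∈ IsManifold.maximalAtlas 𝓘(ℝ, E) ∞ M) :
    φ.MDifferentiable 𝓘(ℝ, E) 𝓘(ℝ, E) :=
  ⟨(contMDiffOn_of_mem_maximalAtlas hφ).mdifferentiableOn (by simp),
   (contMDiffOn_symm_of_mem_maximalAtlas hφ).mdifferentiableOn (by simp)⟩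

/-- The derivative of a chart at a point of its domain. -/
def chartEquiv (hφ : φ ∈ IsManifold.maximalAtlas 𝓘(ℝ, E) ∞ M) {x : M} (hx : x ∈ φ.source) :
    TangentSpace 𝓘(ℝ, E) x ≃L[ℝ] E :=
  (mdifferentiable_of_mem hφ).mfderiv hx

lemma chartEquiv_apply (hφ : φ ∈ IsManifold.maximalAtlas 𝓘(ℝ, E) ∞ M) {x : M} (hx : x ∈ φ.source)
    (v : TangentSpace 𝓘(ℝ, E) x) :
    chartEquiv hφ hx v = (mfderiv 𝓘(ℝ, E) 𝓘(ℝ, E) φ x v : E) := rfl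

lemma chartEquiv_symm_apply (hφ : φ ∈ IsManifold.maximalAtlas 𝓘(ℝ, E) ∞ M) {x : M}
    (hx : x ∈ φ.source) (v : E) :
    (chartEquiv hφ hx).symm v = (mfderiv 𝓘(ℝ, E) 𝓘(ℝ, E) φ.symm (φ x) v : E) := rfl

lemma transition (hφ : φ ∈ IsManifold.maximalAtlas 𝓘(ℝ, E) ∞ M)
    (hψ : ψ ∈ IsManifold.maximalAtlas 𝓘(ℝ, E) ∞ M) {x : M} (hx : x ∈ φ.source)
    (hx' : x ∈ ψ.source) (v : E) :
    chartEquiv hψ hx' ((chartEquiv hφ hx).symm v) = fderiv ℝ (ψ ∘ φ.symm) (φ x) v := by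
  have h1 : MDifferentiableAt 𝓘(ℝ, E) 𝓘(ℝ, E) φ.symm (φ x) :=
    (mdifferentiable_of_mem hφ).mdifferentiableAt_symm (φ.map_source hx)
  have h2 : MDifferentiableAt 𝓘(ℝ, E) 𝓘(ℝ, E) ψ (φ.symm (φ x)) := by
    rw [φ.left_inv hx]; exact (mdifferentiable_of_mem hψ).mdifferentiableAt hx'
  have h3 := mfderiv_comp (φ x) h2 h1
  rw [mfderiv_eq_fderiv] at h3
  rw [chartEquiv_apply, chartEquiv_symm_apply, h3, φ.left_inv hx]
  rfl

lemma contDiffAt_transition (hφ : φ ∈ IsManifold.maximalAtlas 𝓘(ℝ, E) ∞ M)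
    (hψ : ψ ∈ IsManifold.maximalAtlas 𝓘(ℝ, E) ∞ M) {x : M} (hx : x ∈ φ.source)
    (hx' : x ∈ ψ.source) : 
    ContMDiffAt 𝓘(ℝ, E) 𝓘(ℝ, E →L[ℝ] E) ∞ (fun y => fderiv ℝ (ψ ∘ φ.symm) (φ y)) x := by
  have h : ContDiffAt ℝ ∞ (ψ ∘ φ.symm) (φ x) := by
    rw [← contMDiffAt_iff_contDiffAt]
    refine ContMDiffAt.comp (φ x) ?_ (contMDiffAt_symm_of_mem_maximalAtlas hφ (φ.map_source hx))
    rw [φ.left_inv hx]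
    exact contMDiffAt_of_mem_maximalAtlas hψ hx'
  exact (h.fderiv_right (m := ∞) (by simp)).contMDiffAt.comp x (contMDiffAt_of_mem_maximalAtlas hφ hx)

end

section
variable {E : Type*} [NormedAddCommGroup E] [NormedSpace ℝ E] [FiniteDimensional ℝ E]
  {M : Type*} [TopologicalSpace M]
  [ChartedSpace E M] [IsManifold 𝓘(ℝ, E) ∞ M] (𝓕 : Foliation E M)

/-- The fibre at `x` of the vector bundle `T𝓕`. -/
def Tan (x : M) : Type _ := 𝓕.tangent x

instance (x : M) : AddCommGroup (𝓕.Tan x) := inferInstanceAs (AddCommGroup (𝓕.tangent x))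
instance (x : M) : Module ℝ (𝓕.Tan x) := inferInstanceAs (Module ℝ (𝓕.tangent x))
instance (x : M) : TopologicalSpace (𝓕.Tan x) := inferInstanceAs (TopologicalSpace (𝓕.tangent x))
instance (x : M) : IsTopologicalAddGroup (𝓕.Tan x) :=
  inferInstanceAs (IsTopologicalAddGroup (𝓕.tangent x))
instance (x : M) : ContinuousSMul ℝ (𝓕.Tan x) :=
  inferInstanceAs (ContinuousSMul ℝ (𝓕.tangent x))

/-- The canonical inclusion `T𝓕 → TM`, at the point `x`. -/
def incl (x : M) : 𝓕.Tan x →L[ℝ] TangentSpace 𝓘(ℝ, E) x := (𝓕.tangent x).subtypeL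

lemma incl_injective (x : M) : Function.Injective (𝓕.incl x) := Subtype.val_injective

lemma range_incl (x : M) : (𝓕.incl x).range = 𝓕.tangent x := Submodule.range_subtype _

/-- A foliated chart. -/
structure IsFlat (φ : OpenPartialHomeomorph M E) : Prop where
  mem_maximalAtlas : φ ∈ IsManifold.maximalAtlas 𝓘(ℝ, E) ∞ M
  mem_tangent_iff : ∀ y ∈ φ.source, ∀ v : TangentSpace 𝓘(ℝ, E) y,
      v ∈ 𝓕.tangent y ↔ (mfderiv 𝓘(ℝ, E) 𝓘(ℝ, E) φ y v : E) ∈ 𝓕.model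

variable {𝓕} in
/-- The derivative of a foliated chart, restricted to the tangent space of the leaf. -/
def IsFlat.equiv {φ : OpenPartialHomeomorph M E} (h : 𝓕.IsFlat φ) {x : M} (hx : x ∈ φ.source) :
    𝓕.Tan x ≃L[ℝ] 𝓕.model :=
  (chartEquiv h.mem_maximalAtlas hx).submoduleMap (𝓕.tangent x) |>.trans
    (ContinuousLinearEquiv.ofEq _ _ (by
      ext v
      constructor
      · rintro ⟨w, hw, rfl⟩
        exact (h.mem_tangent_iff x hx w).1 hw
      · intro hv
        refine ⟨(chartEquiv h.mem_maximalAtlas hx).symm v, ?_, by simp⟩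
        refine (h.mem_tangent_iff x hx _).2 ?_
        rw [← chartEquiv_apply h.mem_maximalAtlas hx]
        rw [ContinuousLinearEquiv.apply_symm_apply]; exact hv))

lemma IsFlat.coe_equiv {φ : OpenPartialHomeomorph M E} (h : 𝓕.IsFlat φ) {x : M}
    (hx : x ∈ φ.source) (v : 𝓕.Tan x) :
    (h.equiv hx v : E) = chartEquiv h.mem_maximalAtlas hx (𝓕.incl x v) := rfl

lemma IsFlat.incl_equiv_symm {φ : OpenPartialHomeomorph M E} (h : 𝓕.IsFlat φ) {x : M}
    (hx : x ∈ φ.source) (k : 𝓕.model) :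
    𝓕.incl x ((h.equiv hx).symm k) = (chartEquiv h.mem_maximalAtlas hx).symm (k : E) := by
  apply (chartEquiv h.mem_maximalAtlas hx).injective
  rw [← IsFlat.coe_equiv 𝓕 h hx, ContinuousLinearEquiv.apply_symm_apply,
    ContinuousLinearEquiv.apply_symm_apply]

open Classical in
variable {𝓕} in
/-- The local trivialization of `T𝓕` given by a foliated chart. -/
def IsFlat.pretriv {φ : OpenPartialHomeomorph M E} (h : 𝓕.IsFlat φ) :
    Pretrivialization 𝓕.model (π 𝓕.model 𝓕.Tan) where
  toFun p := (p.1, if hp : p.1 ∈ φ.source then h.equiv hp p.2 else 0)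
  invFun p := ⟨p.1, if hp : p.1 ∈ φ.source then (h.equiv hp).symm p.2 else 0⟩
  source := π 𝓕.model 𝓕.Tan ⁻¹' φ.source
  target := φ.source ×ˢ univ
  map_source' _ hp := ⟨hp, mem_univ _⟩
  map_target' _ hp := hp.1
  left_inv' := by
    rintro ⟨x, v⟩ hx
    have hx : x ∈ φ.source := hx
    simp [hx]
  right_inv' := by
    rintro ⟨x, v⟩ ⟨hx, -⟩
    have hx : x ∈ φ.source := hx
    simp [hx]
  open_target := φ.open_source.prod isOpen_univ
  baseSet := φ.source
  open_baseSet := φ.open_source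
  source_eq := rfl
  target_eq := rfl
  proj_toFun _ _ := rfl

lemma IsFlat.pretriv_apply {φ : OpenPartialHomeomorph M E} (h : 𝓕.IsFlat φ) {x : M}
    (hx : x ∈ φ.source) (v : 𝓕.Tan x) : h.pretriv ⟨x, v⟩ = (x, h.equiv hx v) := by
  show (x, _) = _
  simp [hx]

lemma IsFlat.pretriv_isLinear {φ : OpenPartialHomeomorph M E} (h : 𝓕.IsFlat φ) :
    h.pretriv.IsLinear ℝ where
  linear x hx := by
    have hx : x ∈ φ.source := hx
    constructor <;> intros <;> simp [h.pretriv_apply 𝓕 hx]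

lemma IsFlat.pretriv_symm_apply {φ : OpenPartialHomeomorph M E} (h : 𝓕.IsFlat φ) {x : M}
    (hx : x ∈ φ.source) (k : 𝓕.model) : h.pretriv.symm x k = (h.equiv hx).symm k := by
  have := h.pretriv_apply 𝓕 hx ((h.equiv hx).symm k)
  rw [ContinuousLinearEquiv.apply_symm_apply] at this
  have h2 := h.pretriv.symm_apply_apply_mk (b := x) hx ((h.equiv hx).symm k)
  rw [this] at h2
  exact h2

lemma exists_proj : ∃ f : E →L[ℝ] 𝓕.model, ∀ x : 𝓕.model, f x = x :=
  Submodule.ClosedComplemented.of_finiteDimensional 𝓕.model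

lemma IsFlat.exists_coordChange {φ ψ : OpenPartialHomeomorph M E} (hφ : 𝓕.IsFlat φ)
    (hψ : 𝓕.IsFlat ψ) : ∃ f : M → 𝓕.model →L[ℝ] 𝓕.model,
      ContMDiffOn 𝓘(ℝ, E) 𝓘(ℝ, 𝓕.model →L[ℝ] 𝓕.model) ∞ f (φ.source ∩ ψ.source) ∧
      ∀ b ∈ φ.source ∩ ψ.source, ∀ v : 𝓕.model,
        f b v = (hψ.pretriv ⟨b, hφ.pretriv.symm b v⟩).2 := by
  obtain ⟨P, hP⟩ := 𝓕.exists_proj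
  refine ⟨fun b => P ∘L (fderiv ℝ (ψ ∘ φ.symm) (φ b)) ∘L 𝓕.model.subtypeL, ?_, ?_⟩
  · intro x hx
    have h := contDiffAt_transition hφ.mem_maximalAtlas hψ.mem_maximalAtlas hx.1 hx.2
    exact (contMDiffAt_const.clm_comp (h.clm_comp contMDiffAt_const)).contMDiffWithinAt
  · rintro b ⟨hb, hb'⟩ v
    rw [hφ.pretriv_symm_apply 𝓕 hb, hψ.pretriv_apply 𝓕 hb']
    simp only [ContinuousLinearMap.comp_apply, Submodule.subtypeL_apply]
    rw [← transition hφ.mem_maximalAtlas hψ.mem_maximalAtlas hb hb', ← hφ.incl_equiv_symm 𝓕 hb,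
      ← hψ.coe_equiv 𝓕 hb', hP]

/-- A choice of a foliated chart around `x`. -/
def flatChartAt (x : M) : OpenPartialHomeomorph M E := (𝓕.exists_flat_chart x).choose

lemma isFlat_flatChartAt (x : M) : 𝓕.IsFlat (𝓕.flatChartAt x) :=
  ⟨(𝓕.exists_flat_chart x).choose_spec.1, (𝓕.exists_flat_chart x).choose_spec.2.2⟩

lemma mem_flatChartAt_source (x : M) : x ∈ (𝓕.flatChartAt x).source :=
  (𝓕.exists_flat_chart x).choose_spec.2.1

/-- `T𝓕` as a vector bundle with fibre `𝓕.model`: the local trivializations are the restrictions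
of the derivatives of the foliated charts. -/
def prebundle : VectorPrebundle ℝ 𝓕.model 𝓕.Tan where
  pretrivializationAtlas := {e | ∃ φ, ∃ h : 𝓕.IsFlat φ, e = h.pretriv}
  pretrivialization_linear' := by
    rintro e ⟨φ, h, rfl⟩
    exact h.pretriv_isLinear
  pretrivializationAt x := (𝓕.isFlat_flatChartAt x).pretriv
  mem_base_pretrivializationAt x := 𝓕.mem_flatChartAt_source x
  pretrivialization_mem_atlas x := ⟨_, 𝓕.isFlat_flatChartAt x, rfl⟩
  exists_coordChange := by
    rintro e ⟨φ, h, rfl⟩ e' ⟨ψ, h', rfl⟩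
    obtain ⟨f, hf, hf'⟩ := h.exists_coordChange 𝓕 h'
    exact ⟨f, hf.continuousOn, hf'⟩
  totalSpaceMk_isInducing x := by
    have h := 𝓕.mem_flatChartAt_source x
    have : (𝓕.isFlat_flatChartAt x).pretriv ∘ TotalSpace.mk x =
        fun v : 𝓕.Tan x => (x, (𝓕.isFlat_flatChartAt x).equiv h v) := by
      funext v
      exact IsFlat.pretriv_apply 𝓕 _ h v
    rw [this]
    exact (Topology.isInducing_const_prod.2 ((𝓕.isFlat_flatChartAt x).equiv h).toHomeomorph.isInducing)

instance : TopologicalSpace (TotalSpace 𝓕.model 𝓕.Tan) := 𝓕.prebundle.totalSpaceTopology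
instance : FiberBundle 𝓕.model 𝓕.Tan := 𝓕.prebundle.toFiberBundle
instance : VectorBundle ℝ 𝓕.model 𝓕.Tan := 𝓕.prebundle.toVectorBundle

instance : 𝓕.prebundle.IsContMDiff 𝓘(ℝ, E) ∞ where
  exists_contMDiffCoordChange := by
    rintro e ⟨φ, h, rfl⟩ e' ⟨ψ, h', rfl⟩
    exact h.exists_coordChange 𝓕 h'

instance : ContMDiffVectorBundle ∞ 𝓕.model 𝓕.Tan 𝓘(ℝ, E) :=
  𝓕.prebundle.contMDiffVectorBundle 𝓘(ℝ, E)

lemma mem_baseSet_iff {x y : M} : y ∈ (trivializationAt 𝓕.model 𝓕.Tan x).baseSet ↔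
    y ∈ (𝓕.flatChartAt x).source := Iff.rfl

lemma trivializationAt_apply {x y : M} (hy : y ∈ (𝓕.flatChartAt x).source) (v : 𝓕.Tan y) :
    trivializationAt 𝓕.model 𝓕.Tan x ⟨y, v⟩ = (y, (𝓕.isFlat_flatChartAt x).equiv hy v) :=
  IsFlat.pretriv_apply 𝓕 _ hy v

lemma trivializationAt_symm {x y : M} (hy : y ∈ (𝓕.flatChartAt x).source) (k : 𝓕.model) :
    (trivializationAt 𝓕.model 𝓕.Tan x).symm y k = ((𝓕.isFlat_flatChartAt x).equiv hy).symm k := by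
  have := 𝓕.trivializationAt_apply hy (((𝓕.isFlat_flatChartAt x).equiv hy).symm k)
  rw [ContinuousLinearEquiv.apply_symm_apply] at this
  have h2 := (trivializationAt 𝓕.model 𝓕.Tan x).symm_apply_apply_mk (b := y) hy
    (((𝓕.isFlat_flatChartAt x).equiv hy).symm k)
  rw [this] at h2
  exact h2

lemma tangent_trivializationAt_snd {x y : M} (hy : y ∈ (chartAt E x).source)
    (v : TangentSpace 𝓘(ℝ, E) y) :
    (trivializationAt E (TangentSpace 𝓘(ℝ, E)) x ⟨y, v⟩).2 =
      chartEquiv (IsManifold.chart_mem_maximalAtlas x) hy v := by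
  have := TangentBundle.continuousLinearMapAt_trivializationAt (I := 𝓘(ℝ, E)) hy
  have h2 := (trivializationAt E (TangentSpace 𝓘(ℝ, E) : M → Type _) x).continuousLinearMapAt_apply_of_mem
    (R := ℝ) hy v
  rw [← h2, this, chartEquiv_apply]
  rfl

lemma contMDiff_incl : ContMDiff 𝓘(ℝ, E) (𝓘(ℝ, E).prod 𝓘(ℝ, 𝓕.model →L[ℝ] E)) ∞
    (fun x => TotalSpace.mk' (𝓕.model →L[ℝ] E)
      (E := fun x : M => 𝓕.Tan x →L[ℝ] TangentSpace 𝓘(ℝ, E) x) x (𝓕.incl x)) := by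
  intro x
  rw [contMDiffAt_hom_bundle]
  refine ⟨contMDiffAt_id, ?_⟩
  have hf := 𝓕.isFlat_flatChartAt x
  have hx := 𝓕.mem_flatChartAt_source x
  have hc := IsManifold.chart_mem_maximalAtlas (I := 𝓘(ℝ, E)) (n := ∞) x
  have h := contDiffAt_transition hf.mem_maximalAtlas hc hx (mem_chart_source E x)
  have h2 : ContMDiffAt 𝓘(ℝ, E) 𝓘(ℝ, 𝓕.model →L[ℝ] E) ∞ (fun y =>
    fderiv ℝ (chartAt E x ∘ (𝓕.flatChartAt x).symm) (𝓕.flatChartAt x y) ∘L 𝓕.model.subtypeL) x :=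
    h.clm_comp contMDiffAt_const
  refine h2.congr_of_eventuallyEq ?_
  filter_upwards [(𝓕.flatChartAt x).open_source.mem_nhds hx,
    (chartAt E x).open_source.mem_nhds (mem_chart_source E x)] with y hy hy'
  rw [ContinuousLinearMap.inCoordinates_eq hy hy']
  ext k
  simp only [ContinuousLinearMap.comp_apply, Submodule.subtypeL_apply]
  rw [← transition hf.mem_maximalAtlas hc hy hy', ← hf.incl_equiv_symm 𝓕 hy]
  erw [← tangent_trivializationAt_snd hy']
  rw [← 𝓕.trivializationAt_symm hy]
  rfl

/-- A tangent vector of `M` lying in the distribution, as an element of the fibre of `T𝓕`. -/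
def mkTan {x : M} (v : TangentSpace 𝓘(ℝ, E) x) (hv : v ∈ 𝓕.tangent x) : 𝓕.Tan x := ⟨v, hv⟩

@[simp] lemma incl_mkTan {x : M} (v : TangentSpace 𝓘(ℝ, E) x) (hv : v ∈ 𝓕.tangent x) :
    𝓕.incl x (𝓕.mkTan v hv) = v := rfl

/-- A smooth vector field on `M` which is tangent to `𝓕` is a smooth section of `T𝓕`. -/
lemma contMDiff_lift {X : ∀ x : M, TangentSpace 𝓘(ℝ, E) x}
    (hX : ContMDiff 𝓘(ℝ, E) (𝓘(ℝ, E).prod 𝓘(ℝ, E)) ∞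
      (fun x => (TotalSpace.mk' E x (X x) : TangentBundle 𝓘(ℝ, E) M)))
    (h : ∀ x, X x ∈ 𝓕.tangent x) :
    ContMDiff 𝓘(ℝ, E) (𝓘(ℝ, E).prod 𝓘(ℝ, 𝓕.model)) ∞
      (fun x => TotalSpace.mk' 𝓕.model (E := 𝓕.Tan) x (𝓕.mkTan (X x) (h x))) := by
  intro x
  have h0 := hX x
  rw [Bundle.contMDiffAt_section] at h0 ⊢
  have hf := 𝓕.isFlat_flatChartAt x
  have hx := 𝓕.mem_flatChartAt_source x
  have hc := IsManifold.chart_mem_maximalAtlas (I := 𝓘(ℝ, E)) (n := ∞) x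
  have h1 := contDiffAt_transition hc hf.mem_maximalAtlas (mem_chart_source E x) hx
  obtain ⟨P, hP⟩ := 𝓕.exists_proj
  have h2 : ContMDiffAt 𝓘(ℝ, E) 𝓘(ℝ, 𝓕.model) ∞ (fun y =>
      P (fderiv ℝ (𝓕.flatChartAt x ∘ (chartAt E x).symm) (chartAt E x y)
        (trivializationAt E (TangentSpace 𝓘(ℝ, E)) x ⟨y, X y⟩).2)) x :=
    contMDiffAt_const.clm_apply (h1.clm_apply h0)
  refine h2.congr_of_eventuallyEq ?_
  filter_upwards [(𝓕.flatChartAt x).open_source.mem_nhds hx,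
    (chartAt E x).open_source.mem_nhds (mem_chart_source E x)] with y hy hy'
  rw [tangent_trivializationAt_snd hy', ← transition hc hf.mem_maximalAtlas hy' hy,
    ContinuousLinearEquiv.symm_apply_apply]
  rw [𝓕.trivializationAt_apply hy]
  exact ((hP _).symm.trans (congrArg P (hf.coe_equiv 𝓕 hy _)))

/-- The tangent distribution of a foliation is involutive. -/
lemma mlieBracket_mem {X Y : ∀ x : M, TangentSpace 𝓘(ℝ, E) x}
    (hX : ContMDiff 𝓘(ℝ, E) (𝓘(ℝ, E).prod 𝓘(ℝ, E)) ∞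
      (fun x => (TotalSpace.mk' E x (X x) : TangentBundle 𝓘(ℝ, E) M)))
    (hY : ContMDiff 𝓘(ℝ, E) (𝓘(ℝ, E).prod 𝓘(ℝ, E)) ∞
      (fun x => (TotalSpace.mk' E x (Y x) : TangentBundle 𝓘(ℝ, E) M)))
    (hX' : ∀ x, X x ∈ 𝓕.tangent x) (hY' : ∀ x, Y x ∈ 𝓕.tangent x) (x : M) :
    VectorField.mlieBracket 𝓘(ℝ, E) X Y x ∈ 𝓕.tangent x := by
  have : CompleteSpace E := FiniteDimensional.complete ℝ E
  have hs : minSmoothness ℝ 2 = 2 := by simp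
  have := isManifold_minSmoothness E M
  obtain ⟨P, hP⟩ := 𝓕.exists_proj
  have hf := 𝓕.isFlat_flatChartAt x
  have hx := 𝓕.mem_flatChartAt_source x
  generalize 𝓕.flatChartAt x = φ at hf hx
  obtain ⟨e, he, rfl⟩ : ∃ e ∈ φ.target, φ.symm e = x := ⟨φ x, φ.map_source hx, φ.left_inv hx⟩
  have hd := mdifferentiable_of_mem hf.mem_maximalAtlas
  -- the pulled back fields take values in the model subspace
  have hinv : ∀ z ∈ φ.target, ∀ w : TangentSpace 𝓘(ℝ, E) (φ.symm z),
      ((mfderiv 𝓘(ℝ, E) 𝓘(ℝ, E) φ.symm z).inverse w : E) =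
        (mfderiv 𝓘(ℝ, E) 𝓘(ℝ, E) φ (φ.symm z) w : E) := by
    intro z hz w
    have h1 := hd.comp_symm_deriv hz
    have h2 := hd.symm.comp_symm_deriv (x := φ.symm z) (φ.map_target hz)
    have h2' : (mfderiv 𝓘(ℝ, E) 𝓘(ℝ, E) φ.symm z).comp (mfderiv 𝓘(ℝ, E) 𝓘(ℝ, E) φ (φ.symm z)) =
        ContinuousLinearMap.id ℝ (TangentSpace 𝓘(ℝ, E) (φ.symm z)) := by
      have h3 := hd.symm_comp_deriv (φ.map_target hz)
      rwa [φ.right_inv hz] at h3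
    exact congrArg (fun L => (L w : E)) (ContinuousLinearMap.inverse_eq h2' h1)
  have key : ∀ Z : ∀ x : M, TangentSpace 𝓘(ℝ, E) x, ∀ z ∈ φ.target,
      (Z (φ.symm z) ∈ 𝓕.tangent (φ.symm z) ↔
        (VectorField.mpullback 𝓘(ℝ, E) 𝓘(ℝ, E) φ.symm Z z : E) ∈ 𝓕.model) := by
    intro Z z hz
    rw [VectorField.mpullback_apply, hf.mem_tangent_iff _ (φ.map_target hz)]
    exact iff_of_eq (congrArg (· ∈ 𝓕.model) (hinv z hz _).symm)
  have hfd : ∀ V : E → E, (∀ᶠ z in 𝓝 e, V z ∈ 𝓕.model) → ∀ w, fderiv ℝ V e w ∈ 𝓕.model := by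
    intro V hV w
    by_cases hVd : DifferentiableAt ℝ V e
    · have h1 : V =ᶠ[𝓝 e] fun z => (𝓕.model.subtypeL ∘L P) (V z) := by
        filter_upwards [hV] with z hz
        simpa using (congrArg Subtype.val (hP ⟨V z, hz⟩)).symm
      have h2 : HasFDerivAt (fun z => (𝓕.model.subtypeL ∘L P) (V z))
          ((𝓕.model.subtypeL ∘L P) ∘L fderiv ℝ V e) e :=
        (𝓕.model.subtypeL ∘L P).hasFDerivAt.comp e hVd.hasFDerivAt
      rw [h1.fderiv_eq, h2.fderiv]
      exact (P (fderiv ℝ V e w)).2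
    · rw [fderiv_zero_of_not_differentiableAt hVd]
      exact 𝓕.model.zero_mem
  rw [key _ e he]
  rw [VectorField.mpullback_mlieBracket (n := ∞) ((hX _).mdifferentiableAt (by simp))
    ((hY _).mdifferentiableAt (by simp)) (contMDiffAt_symm_of_mem_maximalAtlas hf.mem_maximalAtlas he)
    (by rw [hs]; norm_cast)]
  have hE : ∀ V W : E → E, (VectorField.mlieBracket 𝓘(ℝ, E) V W e : E) =
      VectorField.lieBracket ℝ V W e := by
    intro V W
    have h1 := congrFun (VectorField.mlieBracketWithin_eq_lieBracketWithin (𝕜 := ℝ)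
      (V := V) (W := W) (s := univ)) e
    have h2 := congrFun (VectorField.lieBracketWithin_univ (𝕜 := ℝ) (V := V) (W := W)) e
    exact h1.trans h2
  refine (congrArg (· ∈ 𝓕.model) (hE _ _)).mpr ?_
  have hmem : ∀ᶠ z in 𝓝 e, z ∈ φ.target := φ.open_target.mem_nhds he
  exact 𝓕.model.sub_mem
    (hfd _ (by filter_upwards [hmem] with z hz using (key Y z hz).1 (hY' _)) _)
    (hfd _ (by filter_upwards [hmem] with z hz using (key X z hz).1 (hX' _)) _)

end

/-! ### Partial Nijenhuis operators -/

section PNO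

variable {E : Type*} [NormedAddCommGroup E] [NormedSpace ℝ E] [FiniteDimensional ℝ E]
  {M : Type*} [TopologicalSpace M] [ChartedSpace E M] [IsManifold 𝓘(ℝ, E) ∞ M] (𝓕 : Foliation E M)

/-- The canonical inclusion `T𝓕 → TM` as a morphism of vector bundles. -/
def inclusion : HomToTangent E 𝓕.model 𝓕.Tan := ⟨𝓕.incl, 𝓕.contMDiff_incl⟩

/-- `Γ(T𝓕)`. -/
abbrev Section : Type _ := Cₛ^∞⟮𝓘(ℝ, E); 𝓕.model, 𝓕.Tan⟯

/-- A vector field tangent to `𝓕`, as a section of `T𝓕`. -/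
def lift (X : SmoothVectorField E M) (h : ∀ x, X x ∈ 𝓕.tangent x) : 𝓕.Section :=
  ⟨fun x => 𝓕.mkTan (X x) (h x), 𝓕.contMDiff_lift X.contMDiff h⟩

/-- The canonical bracket on `Γ(T𝓕)`: the commutator of vector fields tangent to `𝓕`. -/
def bracket (X Y : 𝓕.Section) : 𝓕.Section :=
  𝓕.lift (lieBracketField (𝓕.inclusion.map X) (𝓕.inclusion.map Y))
    (𝓕.mlieBracket_mem (𝓕.inclusion.map X).contMDiff (𝓕.inclusion.map Y).contMDiff
      (fun x => (X x).2) (fun x => (Y x).2))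

variable {𝓕}

/-- The vector field `[NX, Y] + [X, NY] - N[X, Y]` on `M`, for `X, Y ∈ Γ(T𝓕)`. -/
def deformedField (N : HomToTangent E 𝓕.model 𝓕.Tan) (X Y : 𝓕.Section) : SmoothVectorField E M :=
  lieBracketField (N.map X) (𝓕.inclusion.map Y) + lieBracketField (𝓕.inclusion.map X) (N.map Y) -
    N.map (𝓕.bracket X Y)

/-- `(T𝓕, N)` is a partial Nijenhuis operator: `[X, Y]_N` is tangent to `𝓕`, and
`[NX, NY] = N [X, Y]_N`, for all `X, Y ∈ Γ(T𝓕)`. -/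
structure IsPNO (N : HomToTangent E 𝓕.model 𝓕.Tan) : Prop where
  mem : ∀ X Y x, deformedField N X Y x ∈ 𝓕.tangent x
  torsion : ∀ X Y, lieBracketField (N.map X) (N.map Y) = N.map (𝓕.lift (deformedField N X Y) (mem X Y))

/-- The bracket `[,]_N` on `Γ(T𝓕)` of a partial Nijenhuis operator. -/
def IsPNO.bracket {N : HomToTangent E 𝓕.model 𝓕.Tan} (hN : IsPNO N) (X Y : 𝓕.Section) : 𝓕.Section :=
  𝓕.lift (deformedField N X Y) (hN.mem X Y)

end PNO

end Foliation

end

/-! For a vector bundle `V`, consider the functions on `V*` that are a fibrewise linear function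
plus a base function, parametrised by pairs (X, f) in Γ(V) × C^∞(M) (`generatorFun`). By
`differential_generatorFun_surjective` their differentials fill every cotangent space, so a bivector
is determined by the brackets of these generators. The three defining identities say that those
brackets come from the semidirect product bracket ([X, Y], ρ(X)g - ρ(Y)f) on pairs
(`IsLinearPoisson.bracket_generatorFun`), which gives uniqueness.

The same fact yields the pushforward formula. Composing the generator of (X, f) with the transposed
anchor gives the generator of (ρX, f), and since ρ[X, Y] = [ρX, ρY], the map (X, f) ↦ (ρX, f)
respects the semidirect brackets. Hence the transposed anchor of any Lie algebroid is a Poisson map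
(`IsLieAlgebroid.isPushforward_transpose`); the theorem is the case ρ = N.

For existence, covectors are lifted to pairs and the semidirect bracket is evaluated. The value does
not depend on the lift because it vanishes as soon as the differential of one generator does
(`generatorFun_generatorBracket_eq_zero`). The Jacobiator of a bivector is tensorial
(`IsCoordinateSystem.jacobiator_congr`), so it need only vanish on generators, where it reduces to
the Jacobi identity for pairs.

That [,]_N makes T𝓕 a Lie algebroid is the classical deformation argument: its Jacobi identity is a
formal consequence of vanishing torsion (`jacobi_of_torsion_eq_zero`), and vanishing torsion is
itself the anchor identity. -/

noncomputable section

set_option linter.unusedSectionVars false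

/-! ### The Lie ring of vector fields -/

section VectorFields

variable {E : Type*} [NormedAddCommGroup E] [NormedSpace ℝ E] [FiniteDimensional ℝ E]
  {M : Type*} [TopologicalSpace M] [ChartedSpace E M] [IsManifold 𝓘(ℝ, E) ∞ M]
  {F : Type*} [NormedAddCommGroup F] [NormedSpace ℝ F] {V : M → Type*}
  [TopologicalSpace (TotalSpace F V)] [∀ x, AddCommGroup (V x)] [∀ x, Module ℝ (V x)]
  [∀ x, TopologicalSpace (V x)] [FiberBundle F V] [VectorBundle ℝ F V]

lemma HomToTangent.map_add (ρ : HomToTangent E F V) (X Y : Cₛ^∞⟮𝓘(ℝ, E); F, V⟯) :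
    ρ.map (X + Y) = ρ.map X + ρ.map Y :=
  ContMDiffSection.ext fun x => _root_.map_add (ρ x) (X x) (Y x)

lemma HomToTangent.map_smul (ρ : HomToTangent E F V) (c : ℝ) (X : Cₛ^∞⟮𝓘(ℝ, E); F, V⟯) :
    ρ.map (c • X) = c • ρ.map X :=
  ContMDiffSection.ext fun x => _root_.map_smul (ρ x) c (X x)

lemma HomToTangent.map_funSMul (ρ : HomToTangent E F V) (f : C^∞⟮𝓘(ℝ, E), M; ℝ⟯)
    (X : Cₛ^∞⟮𝓘(ℝ, E); F, V⟯) : ρ.map (funSMul f X) = funSMul f (ρ.map X) :=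
  ContMDiffSection.ext fun x => _root_.map_smul (ρ x) (f x) (X x)

lemma lieBracketField_self (X : SmoothVectorField E M) : lieBracketField X X = 0 :=
  ContMDiffSection.ext fun x => congrFun VectorField.mlieBracket_self x

lemma lieBracketField_add_left (X Y Z : SmoothVectorField E M) :
    lieBracketField (X + Y) Z = lieBracketField X Z + lieBracketField Y Z :=
  ContMDiffSection.ext fun _ =>
    VectorField.mlieBracket_add_left X.mdifferentiableAt Y.mdifferentiableAt

lemma lieBracketField_add_right (X Y Z : SmoothVectorField E M) :
    lieBracketField X (Y + Z) = lieBracketField X Y + lieBracketField X Z :=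
  ContMDiffSection.ext fun _ =>
    VectorField.mlieBracket_add_right Y.mdifferentiableAt Z.mdifferentiableAt

lemma lieBracketField_smul_left (c : ℝ) (X Y : SmoothVectorField E M) :
    lieBracketField (c • X) Y = c • lieBracketField X Y :=
  ContMDiffSection.ext fun _ => VectorField.mlieBracket_const_smul_left X.mdifferentiableAt

lemma lieBracketField_smul_right (c : ℝ) (X Y : SmoothVectorField E M) :
    lieBracketField X (c • Y) = c • lieBracketField X Y :=
  ContMDiffSection.ext fun _ => VectorField.mlieBracket_const_smul_right Y.mdifferentiableAt

lemma lieBracketField_leibniz (X Y Z : SmoothVectorField E M) :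
    lieBracketField X (lieBracketField Y Z) =
      lieBracketField (lieBracketField X Y) Z + lieBracketField Y (lieBracketField X Z) := by
  have : CompleteSpace E := FiniteDimensional.complete ℝ E
  have h3 : IsManifold 𝓘(ℝ, E) (minSmoothness ℝ 3) M := by
    rw [show minSmoothness ℝ 3 = 3 by simp]
    exact IsManifold.of_le (n := ∞) (WithTop.coe_le_coe.2 le_top)
  have h2 : minSmoothness ℝ 2 ≤ ∞ := by
    rw [show minSmoothness ℝ 2 = 2 by simp]
    exact WithTop.coe_le_coe.2 le_top
  exact ContMDiffSection.ext fun x => VectorField.leibniz_identity_mlieBracket_apply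
    ((X.contMDiff x).of_le h2) ((Y.contMDiff x).of_le h2) ((Z.contMDiff x).of_le h2)

/-- The Lie ring of smooth vector fields. -/
@[reducible] def vectorFieldLieRing : LieRing (SmoothVectorField E M) where
  bracket := lieBracketField
  add_lie := lieBracketField_add_left
  lie_add := lieBracketField_add_right
  lie_self := lieBracketField_self
  leibniz_lie := lieBracketField_leibniz

/-- The derivative of a function along a vector field, as a smooth function. -/
def dirDerivMap (X : SmoothVectorField E M) (f : C^∞⟮𝓘(ℝ, E), M; ℝ⟯) : C^∞⟮𝓘(ℝ, E), M; ℝ⟯ where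
  val := dirDeriv X f
  property := by
    have h1 : ContMDiff 𝓘(ℝ, E).tangent 𝓘(ℝ, ℝ).tangent ∞ (tangentMap 𝓘(ℝ, E) 𝓘(ℝ, ℝ) f) :=
      f.contMDiff.contMDiff_tangentMap (by simp)
    exact (contMDiff_snd_tangentBundle_modelSpace ℝ 𝓘(ℝ, ℝ)).comp (h1.comp X.contMDiff)

lemma dirDerivMap_apply (X : SmoothVectorField E M) (f : C^∞⟮𝓘(ℝ, E), M; ℝ⟯) (x : M) :
    dirDerivMap X f x = dirDeriv X f x := rfl

end VectorFields

/-! ### Jacobi identity of a bracket deformed by a torsion-free operator -/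

section Deformation

/-- The Jacobi identity of the bracket `[a, b]_n = [n a, b] + [a, n b] - n [a, b]` on a subobject
`i : A → L` of a Lie ring, for an operator `n : A → L` with vanishing torsion. -/
lemma jacobi_of_torsion_eq_zero {L A : Type*} [LieRing L] [AddCommGroup A] (i n : A →+ L)
    (hi : Function.Injective i) (b bn : A → A → A) (hb : ∀ x y, i (b x y) = ⁅i x, i y⁆)
    (hbn : ∀ x y, i (bn x y) = ⁅n x, i y⁆ + ⁅i x, n y⁆ - n (b x y))
    (ht : ∀ x y, n (bn x y) = ⁅n x, n y⁆) (x y z : A) :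
    bn x (bn y z) + bn y (bn z x) + bn z (bn x y) = 0 := by
  have jac : ∀ u v w : L, ⁅u, ⁅v, w⁆⁆ + ⁅v, ⁅w, u⁆⁆ + ⁅w, ⁅u, v⁆⁆ = 0 := lie_jacobi
  have h0 : b x (b y z) + b y (b z x) + b z (b x y) = 0 := hi (by simp [hb, jac])
  -- Compatibility of the two brackets, which needs no torsion hypothesis: it is the sum of the
  -- Jacobi identities with `n` on exactly one of the three arguments, minus `n` of the Jacobi
  -- identity of `b`.
  have h1 : (bn x (b y z) + b x (bn y z)) + (bn y (b z x) + b y (bn z x)) +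
      (bn z (b x y) + b z (bn x y)) = 0 := by
    apply hi
    have e : n (b x (b y z)) + n (b y (b z x)) + n (b z (b x y)) = 0 := by
      rw [← map_add, ← map_add, h0, map_zero]
    have e1 := jac (n x) (i y) (i z)
    have e2 := jac (i x) (n y) (i z)
    have e3 := jac (i x) (i y) (n z)
    simp only [map_add, map_zero, hb, hbn, lie_add, lie_sub]
    linear_combination (norm := abel1) e1 + e2 + e3 - e
  -- After the Jacobi identities with `n` on two arguments are used, what remains of the deformed
  -- Jacobiator is exactly `n` applied to the compatibility relation.
  have h2 := congrArg n h1
  simp only [map_add, map_zero, ht] at h2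
  apply hi
  have e1 := jac (n x) (n y) (i z)
  have e2 := jac (n x) (i y) (n z)
  have e3 := jac (i x) (n y) (n z)
  simp only [map_add, map_zero, hbn, ht, lie_add, lie_sub] at h2 ⊢
  linear_combination (norm := abel1) e1 + e2 + e3 - h2

end Deformation

/-! ### Linearity of derivatives along vector fields -/

section DirDeriv

variable {E : Type*} [NormedAddCommGroup E] [NormedSpace ℝ E] [FiniteDimensional ℝ E]
  {M : Type*} [TopologicalSpace M] [ChartedSpace E M] [IsManifold 𝓘(ℝ, E) ∞ M]

lemma dirDerivMap_add_left (X Y : SmoothVectorField E M) (f : C^∞⟮𝓘(ℝ, E), M; ℝ⟯) :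
    dirDerivMap (X + Y) f = dirDerivMap X f + dirDerivMap Y f :=
  ContMDiffMap.ext fun x => map_add (differential 𝓘(ℝ, E) f x) (X x) (Y x)

lemma dirDerivMap_smul_left (c : ℝ) (X : SmoothVectorField E M) (f : C^∞⟮𝓘(ℝ, E), M; ℝ⟯) :
    dirDerivMap (c • X) f = c • dirDerivMap X f :=
  ContMDiffMap.ext fun x => map_smul (differential 𝓘(ℝ, E) f x) c (X x)

end DirDeriv

/-! ### Calculus of differentials -/

section Differential

variable {E : Type*} [NormedAddCommGroup E] [NormedSpace ℝ E] {H : Type*} [TopologicalSpace H]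
  {I : ModelWithCorners ℝ E H} {P : Type*} [TopologicalSpace P] [ChartedSpace H P]

lemma hasMFDerivAt_differential (f : C^∞⟮I, P; ℝ⟯) (p : P) :
    HasMFDerivAt I 𝓘(ℝ, ℝ) f p (differential I f p) :=
  (f.contMDiff.mdifferentiable (by simp) p).hasMFDerivAt

lemma differential_add (f g : C^∞⟮I, P; ℝ⟯) (p : P) :
    differential I (f + g : C^∞⟮I, P; ℝ⟯) p = differential I f p + differential I g p :=
  ((hasMFDerivAt_differential f p).add (hasMFDerivAt_differential g p)).mfderiv

lemma differential_smul (c : ℝ) (f : C^∞⟮I, P; ℝ⟯) (p : P) :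
    differential I (c • f : C^∞⟮I, P; ℝ⟯) p = c • differential I f p :=
  ((hasMFDerivAt_differential f p).const_smul c).mfderiv

lemma differential_mul (f g : C^∞⟮I, P; ℝ⟯) (p : P) :
    differential I (f * g : C^∞⟮I, P; ℝ⟯) p = f p • differential I g p + g p • differential I f p :=
  ((hasMFDerivAt_differential f p).mul (hasMFDerivAt_differential g p)).mfderiv

/-- The differential at `p`, as a linear map on smooth functions. -/
def differentialLinear (p : P) : C^∞⟮I, P; ℝ⟯ →ₗ[ℝ] (TangentSpace I p →L[ℝ] ℝ) where
  toFun f := differential I f p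
  map_add' f g := differential_add f g p
  map_smul' c f := differential_smul c f p

lemma differential_congr {f g : P → ℝ} {p : P} (h : f =ᶠ[𝓝 p] g) :
    differential I f p = differential I g p := h.mfderiv_eq

lemma differential_comp {E' : Type*} [NormedAddCommGroup E'] [NormedSpace ℝ E'] {H' : Type*}
    [TopologicalSpace H'] {I' : ModelWithCorners ℝ E' H'} {Q : Type*} [TopologicalSpace Q]
    [ChartedSpace H' Q] (f : C^∞⟮I', Q; ℝ⟯) {φ : P → Q} {p : P} (hφ : MDifferentiableAt I I' φ p) :
    differential I (f ∘ φ) p = differential I' f (φ p) ∘L mfderiv I I' φ p :=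
  ((hasMFDerivAt_differential f (φ p)).comp p hφ.hasMFDerivAt).mfderiv

end Differential

/-! ### The tangent Lie algebroid -/

section DirDeriv

variable {E : Type*} [NormedAddCommGroup E] [NormedSpace ℝ E] [FiniteDimensional ℝ E]
  {M : Type*} [TopologicalSpace M] [ChartedSpace E M] [IsManifold 𝓘(ℝ, E) ∞ M]

lemma dirDeriv_eq_differential (X : SmoothVectorField E M) (f : C^∞⟮𝓘(ℝ, E), M; ℝ⟯) (x : M) :
    dirDeriv X f x = differential 𝓘(ℝ, E) f x (X x) := rfl

lemma dirDerivMap_add_right (X : SmoothVectorField E M) (f g : C^∞⟮𝓘(ℝ, E), M; ℝ⟯) :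
    dirDerivMap X (f + g) = dirDerivMap X f + dirDerivMap X g :=
  ContMDiffMap.ext fun x => by
    show dirDeriv X _ x = dirDeriv X f x + dirDeriv X g x
    rw [dirDeriv_eq_differential, differential_add]; rfl

lemma dirDerivMap_smul_right (c : ℝ) (X : SmoothVectorField E M) (f : C^∞⟮𝓘(ℝ, E), M; ℝ⟯) :
    dirDerivMap X (c • f) = c • dirDerivMap X f :=
  ContMDiffMap.ext fun x => by
    show dirDeriv X _ x = c • dirDeriv X f x
    rw [dirDeriv_eq_differential, differential_smul]; rfl

lemma lieBracketField_funSMul_right (X : SmoothVectorField E M) (f : C^∞⟮𝓘(ℝ, E), M; ℝ⟯)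
    (Y : SmoothVectorField E M) (x : M) : lieBracketField X (funSMul f Y) x =
      f x • lieBracketField X Y x + dirDeriv X f x • Y x := by
  rw [add_comm]
  exact VectorField.mlieBracket_smul_right (f.contMDiff.mdifferentiable (by simp) x)
    Y.mdifferentiableAt

lemma lieBracketField_swap (X Y : SmoothVectorField E M) :
    lieBracketField Y X = -lieBracketField X Y := by
  let _ := vectorFieldLieRing (E := E) (M := M)
  exact (lie_skew Y X).symm

theorem isLieAlgebroid_tangent :
    IsLieAlgebroid (tangentId : HomToTangent E E (TangentSpace 𝓘(ℝ, E) : M → Type _))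
      lieBracketField where
  add_left := lieBracketField_add_left
  add_right := lieBracketField_add_right
  smul_left := lieBracketField_smul_left
  smul_right := lieBracketField_smul_right
  self := lieBracketField_self
  jacobi X Y Z := by
    let _ := vectorFieldLieRing (E := E) (M := M)
    exact lie_jacobi X Y Z
  anchor _ _ := rfl
  leibniz := lieBracketField_funSMul_right

end DirDeriv

/-! ### The Lie algebroid of a partial Nijenhuis operator -/

namespace Foliation

variable {E : Type*} [NormedAddCommGroup E] [NormedSpace ℝ E] [FiniteDimensional ℝ E]
  {M : Type*} [TopologicalSpace M] [ChartedSpace E M] [IsManifold 𝓘(ℝ, E) ∞ M] {𝓕 : Foliation E M}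

/-- Both brackets on Γ(T𝓕) are known through their images in vector fields on `M`, so this reduces
their identities to the calculus of commutators. -/
lemma inclusion_map_injective : Function.Injective (𝓕.inclusion.map) := fun _ _ h =>
  ContMDiffSection.ext fun x => 𝓕.incl_injective x (congrArg (fun Z : SmoothVectorField E M => Z x) h)

lemma inclusion_map_bracket (X Y : 𝓕.Section) : 𝓕.inclusion.map (𝓕.bracket X Y) =
    lieBracketField (𝓕.inclusion.map X) (𝓕.inclusion.map Y) := rfl

lemma bracket_add_left (X Y Z : 𝓕.Section) :
    𝓕.bracket (X + Y) Z = 𝓕.bracket X Z + 𝓕.bracket Y Z :=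
  inclusion_map_injective (by
    simp only [inclusion_map_bracket, HomToTangent.map_add, lieBracketField_add_left])

lemma bracket_add_right (X Y Z : 𝓕.Section) :
    𝓕.bracket X (Y + Z) = 𝓕.bracket X Y + 𝓕.bracket X Z :=
  inclusion_map_injective (by
    simp only [inclusion_map_bracket, HomToTangent.map_add, lieBracketField_add_right])

lemma bracket_smul_left (c : ℝ) (X Y : 𝓕.Section) : 𝓕.bracket (c • X) Y = c • 𝓕.bracket X Y :=
  inclusion_map_injective (by
    simp only [inclusion_map_bracket, HomToTangent.map_smul, lieBracketField_smul_left])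

lemma bracket_smul_right (c : ℝ) (X Y : 𝓕.Section) : 𝓕.bracket X (c • Y) = c • 𝓕.bracket X Y :=
  inclusion_map_injective (by
    simp only [inclusion_map_bracket, HomToTangent.map_smul, lieBracketField_smul_right])

lemma bracket_self (X : 𝓕.Section) : 𝓕.bracket X X = 0 :=
  inclusion_map_injective (by
    rw [inclusion_map_bracket, lieBracketField_self]
    exact ContMDiffSection.ext fun x => (_root_.map_zero (𝓕.incl x)).symm)

lemma bracket_funSMul_right (X : 𝓕.Section) (f : C^∞⟮𝓘(ℝ, E), M; ℝ⟯) (Y : 𝓕.Section) (x : M) :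
    𝓕.bracket X (funSMul f Y) x =
      f x • 𝓕.bracket X Y x + dirDeriv (𝓕.inclusion.map X) f x • Y x := by
  apply 𝓕.incl_injective x
  rw [_root_.map_add, _root_.map_smul, _root_.map_smul]
  exact lieBracketField_funSMul_right (𝓕.inclusion.map X) f (𝓕.inclusion.map Y) x

variable {N : HomToTangent E 𝓕.model 𝓕.Tan}

lemma IsPNO.inclusion_map_bracket (hN : IsPNO N) (X Y : 𝓕.Section) :
    𝓕.inclusion.map (hN.bracket X Y) = lieBracketField (N.map X) (𝓕.inclusion.map Y) +
      lieBracketField (𝓕.inclusion.map X) (N.map Y) - N.map (𝓕.bracket X Y) := rfl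

lemma IsPNO.map_bracket (hN : IsPNO N) (X Y : 𝓕.Section) :
    N.map (hN.bracket X Y) = lieBracketField (N.map X) (N.map Y) := (hN.torsion X Y).symm

theorem IsPNO.isLieAlgebroid (hN : IsPNO N) : IsLieAlgebroid N hN.bracket where
  add_left X Y Z := inclusion_map_injective (by
    simp only [hN.inclusion_map_bracket, HomToTangent.map_add, lieBracketField_add_left,
      bracket_add_left]
    abel)
  add_right X Y Z := inclusion_map_injective (by
    simp only [hN.inclusion_map_bracket, HomToTangent.map_add, lieBracketField_add_right,
      bracket_add_right]
    abel)
  smul_left c X Y := inclusion_map_injective (by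
    simp only [hN.inclusion_map_bracket, HomToTangent.map_smul, lieBracketField_smul_left,
      bracket_smul_left]
    module)
  smul_right c X Y := inclusion_map_injective (by
    simp only [hN.inclusion_map_bracket, HomToTangent.map_smul, lieBracketField_smul_right,
      bracket_smul_right]
    module)
  self X := inclusion_map_injective (by
    have h0 : ∀ ρ : HomToTangent E 𝓕.model 𝓕.Tan, ρ.map 0 = 0 := fun ρ =>
      ContMDiffSection.ext fun x => _root_.map_zero (ρ x)
    rw [hN.inclusion_map_bracket, bracket_self, h0, h0, lieBracketField_swap (N.map X)]
    abel)
  jacobi := by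
    let _ := vectorFieldLieRing (E := E) (M := M)
    exact jacobi_of_torsion_eq_zero
      (AddMonoidHom.mk' 𝓕.inclusion.map 𝓕.inclusion.map_add) (AddMonoidHom.mk' N.map N.map_add)
      inclusion_map_injective 𝓕.bracket hN.bracket (fun _ _ => rfl) (fun _ _ => rfl) hN.map_bracket
  anchor := hN.map_bracket
  leibniz X f Y x := by
    apply 𝓕.incl_injective x
    have h (Z : 𝓕.Section) : 𝓕.incl x (hN.bracket X Z x) =
        lieBracketField (N.map X) (𝓕.inclusion.map Z) x +
        lieBracketField (𝓕.inclusion.map X) (N.map Z) x - N x (𝓕.bracket X Z x) := rfl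
    -- The term (Xf)NY from [X, fNY] cancels against the one from N[X, fY], so only the derivative
    -- of `f` along NX survives.
    rw [_root_.map_add, _root_.map_smul, _root_.map_smul, h, h, HomToTangent.map_funSMul,
      HomToTangent.map_funSMul, lieBracketField_funSMul_right, lieBracketField_funSMul_right,
      bracket_funSMul_right, _root_.map_add, _root_.map_smul, _root_.map_smul]
    have h1 : 𝓕.inclusion.map Y x = 𝓕.incl x (Y x) := rfl
    have h2 : N.map Y x = N x (Y x) := rfl
    rw [h1, h2]
    module

end Foliation

/-! ### Extension of local sections and functions by cutoffs -/

section Bump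

variable {E : Type*} [NormedAddCommGroup E] [NormedSpace ℝ E] [FiniteDimensional ℝ E]
  {M : Type*} [TopologicalSpace M] [T2Space M] [ChartedSpace E M] [IsManifold 𝓘(ℝ, E) ∞ M]
  {F : Type*} [NormedAddCommGroup F] [NormedSpace ℝ F] {V : M → Type*}
  [TopologicalSpace (TotalSpace F V)] [∀ x, AddCommGroup (V x)] [∀ x, Module ℝ (V x)]
  [∀ x, TopologicalSpace (V x)] [FiberBundle F V] [VectorBundle ℝ F V]
  [ContMDiffVectorBundle ∞ F V 𝓘(ℝ, E)]

variable (E) in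
lemma exists_bump {x : M} {s : Set M} (hs : s ∈ 𝓝 x) : ∃ χ : C^∞⟮𝓘(ℝ, E), M; ℝ⟯,
    tsupport χ ⊆ s ∧ ∀ᶠ y in 𝓝 x, χ y = 1 := by
  obtain ⟨f, -, hf⟩ := (SmoothBumpFunction.nhds_basis_tsupport (I := 𝓘(ℝ, E)) x).mem_iff.1 hs
  exact ⟨⟨f, f.contMDiff⟩, hf, f.eventuallyEq_one⟩

/-- The product of a smooth function and a section which is smooth around its support. -/
def cutoffSection (χ : C^∞⟮𝓘(ℝ, E), M; ℝ⟯) {s : ∀ x, V x} {u : Set M} (hu : IsOpen u)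
    (hχ : tsupport χ ⊆ u)
    (hs : ContMDiffOn 𝓘(ℝ, E) (𝓘(ℝ, E).prod 𝓘(ℝ, F)) ∞ (fun x => TotalSpace.mk' F x (s x)) u) :
    Cₛ^∞⟮𝓘(ℝ, E); F, V⟯ :=
  ⟨fun x => χ x • s x, ContMDiffOn.smul_section_of_tsupport χ.contMDiff.contMDiffOn hu hχ hs⟩

/-- The product of a smooth function and a function which is smooth around its support. -/
def cutoffFun (χ : C^∞⟮𝓘(ℝ, E), M; ℝ⟯) {s : M → ℝ} {u : Set M} (hu : IsOpen u)
    (hχ : tsupport χ ⊆ u) (hs : ContMDiffOn 𝓘(ℝ, E) 𝓘(ℝ, ℝ) ∞ s u) : C^∞⟮𝓘(ℝ, E), M; ℝ⟯ :=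
  ⟨fun x => χ x * s x, contMDiff_of_tsupport fun x hx =>
    (χ.contMDiff x).mul (hs.contMDiffAt
      (hu.mem_nhds (hχ (tsupport_smul_subset_left (χ : M → ℝ) s hx))))⟩

lemma exists_section_eventuallyEq {s : ∀ x, V x} {u : Set M} (hu : IsOpen u) {x : M} (hx : x ∈ u)
    (hs : ContMDiffOn 𝓘(ℝ, E) (𝓘(ℝ, E).prod 𝓘(ℝ, F)) ∞ (fun x => TotalSpace.mk' F x (s x)) u) :
    ∃ X : Cₛ^∞⟮𝓘(ℝ, E); F, V⟯, ∀ᶠ y in 𝓝 x, X y = s y := by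
  obtain ⟨χ, hχ, h⟩ := exists_bump E (hu.mem_nhds hx)
  refine ⟨cutoffSection χ hu hχ hs, h.mono fun y hy => ?_⟩
  show χ y • s y = s y
  rw [hy, one_smul]

lemma exists_contMDiffMap_eventuallyEq {s : M → ℝ} {u : Set M} (hu : IsOpen u) {x : M} (hx : x ∈ u)
    (hs : ContMDiffOn 𝓘(ℝ, E) 𝓘(ℝ, ℝ) ∞ s u) :
    ∃ f : C^∞⟮𝓘(ℝ, E), M; ℝ⟯, f =ᶠ[𝓝 x] s := by
  obtain ⟨χ, hχ, h⟩ := exists_bump E (hu.mem_nhds hx)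
  refine ⟨cutoffFun χ hu hχ hs, h.mono fun y hy => ?_⟩
  show χ y * s y = s y
  rw [hy, one_mul]

variable (E) in
/-- Around every point, constant sections in a local trivialization extend to global sections. -/
lemma exists_section_symm (x : M) (v : F) : ∃ X : Cₛ^∞⟮𝓘(ℝ, E); F, V⟯,
    ∀ᶠ y in 𝓝 x, X y = (trivializationAt F V x).symm y v := by
  refine exists_section_eventuallyEq (trivializationAt F V x).open_baseSet
    (FiberBundle.mem_baseSet_trivializationAt' x) ?_
  rw [(trivializationAt F V x).contMDiffOn_section_baseSet_iff]
  refine (contMDiffOn_const (c := v)).congr fun y hy => ?_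
  rw [(trivializationAt F V x).apply_mk_symm hy]

variable (E) in
lemma exists_section_apply_eq (x : M) (v : V x) : ∃ X : Cₛ^∞⟮𝓘(ℝ, E); F, V⟯, X x = v := by
  obtain ⟨X, hX⟩ := exists_section_symm (V := V) E x (trivializationAt F V x ⟨x, v⟩).2
  refine ⟨X, hX.self_of_nhds.trans ?_⟩
  exact (trivializationAt F V x).symm_apply_apply_mk (FiberBundle.mem_baseSet_trivializationAt' x) v

/-- A section vanishing at `x` is, around `x`, a combination of sections with coefficients vanishing
at `x`; multiplying by a cutoff function makes this a global statement. -/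
lemma exists_funSMul_eq_sum [FiniteDimensional ℝ F] (X : Cₛ^∞⟮𝓘(ℝ, E); F, V⟯) {x : M}
    (hX : X x = 0) :
    ∃ (n : ℕ) (ψ : C^∞⟮𝓘(ℝ, E), M; ℝ⟯) (a : Fin n → C^∞⟮𝓘(ℝ, E), M; ℝ⟯)
      (Y : Fin n → Cₛ^∞⟮𝓘(ℝ, E); F, V⟯), ψ x = 1 ∧ (∀ i, a i x = 0) ∧
        funSMul ψ X = ∑ i, funSMul (a i) (Y i) := by
  let e := trivializationAt F V x
  let b := Module.finBasis ℝ F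
  obtain ⟨χ, hχ, h⟩ := exists_bump E
    (e.open_baseSet.mem_nhds (FiberBundle.mem_baseSet_trivializationAt' x))
  have hc (i) := contMDiffOn_baseSet_localFrameCoeff (I := 𝓘(ℝ, E)) (e := e) b (k := ∞)
    X.contMDiff.contMDiffOn i
  have hl (i) := e.contMDiffOn_localFrame_baseSet (I := 𝓘(ℝ, E)) ∞ b i
  -- One factor `χ` globalises the coefficients and the other the frame, which explains the square.
  refine ⟨_, χ * χ, fun i => cutoffFun χ e.open_baseSet hχ (hc i),
    fun i => cutoffSection χ e.open_baseSet hχ (hl i), ?_, fun i => ?_, ?_⟩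
  · show χ x * χ x = 1
    rw [h.self_of_nhds, one_mul]
  · show χ x * e.localFrameCoeff 𝓘(ℝ, E) b i x (X x) = 0
    rw [hX, map_zero, mul_zero]
  · refine ContMDiffSection.ext fun y => ?_
    have hs : (∑ i, funSMul (cutoffFun χ e.open_baseSet hχ (hc i))
        (cutoffSection χ e.open_baseSet hχ (hl i)) : Cₛ^∞⟮𝓘(ℝ, E); F, V⟯) y =
        ∑ i, (χ y * e.localFrameCoeff 𝓘(ℝ, E) b i y (X y)) • χ y • e.localFrame b i y := by
      rw [← ContMDiffSection.coeAddHom_apply, map_sum, Finset.sum_apply]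
      rfl
    rw [hs]
    show (χ y * χ y) • X y = _
    by_cases hy : y ∈ e.baseSet
    · conv_lhs => rw [e.eq_sum_localFrameCoeff_smul (I := 𝓘(ℝ, E)) (b := b) (s := X) hy]
      rw [Finset.smul_sum]
      refine Finset.sum_congr rfl fun i _ => ?_
      module
    · have : χ y = 0 := image_eq_zero_of_notMem_tsupport fun h => hy (hχ h)
      simp [this]

end Bump

/-! ### The commutator as a commutator of derivations -/

section DirDeriv

variable {E : Type*} [NormedAddCommGroup E] [NormedSpace ℝ E] [FiniteDimensional ℝ E]
  {M : Type*} [TopologicalSpace M] [T2Space M] [ChartedSpace E M] [IsManifold 𝓘(ℝ, E) ∞ M]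

/-- Expanding the Jacobi identity of X, Y, fZ by the Leibniz rule and subtracting `f` times that of
X, Y, Z leaves the defect of the formula, as a scalar multiplying Z. -/
lemma dirDerivMap_lieBracketField (X Y : SmoothVectorField E M) (f : C^∞⟮𝓘(ℝ, E), M; ℝ⟯) :
    dirDerivMap (lieBracketField X Y) f =
      dirDerivMap X (dirDerivMap Y f) - dirDerivMap Y (dirDerivMap X f) := by
  refine ContMDiffMap.ext fun x => ?_
  show dirDeriv (lieBracketField X Y) f x =
    dirDeriv X (dirDerivMap Y f) x - dirDeriv Y (dirDerivMap X f) x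
  have key (Z : SmoothVectorField E M) : (dirDeriv (lieBracketField X Y) f x -
      (dirDeriv X (dirDerivMap Y f) x - dirDeriv Y (dirDerivMap X f) x)) • Z x = 0 := by
    have hf (X Y : SmoothVectorField E M) : lieBracketField X (funSMul f Y) =
        funSMul f (lieBracketField X Y) + funSMul (dirDerivMap X f) Y :=
      ContMDiffSection.ext fun x => lieBracketField_funSMul_right X f Y x
    have h := congrArg (fun W : SmoothVectorField E M => W x)
      (lieBracketField_leibniz X Y (funSMul f Z))
    have h' := congrArg (fun W : SmoothVectorField E M => W x) (lieBracketField_leibniz X Y Z)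
    simp only [hf, lieBracketField_add_right, ContMDiffSection.coe_add, Pi.add_apply,
      lieBracketField_funSMul_right, dirDerivMap_apply] at h h'
    have e (g : C^∞⟮𝓘(ℝ, E), M; ℝ⟯) (W : SmoothVectorField E M) : funSMul g W x = g x • W x := rfl
    simp only [e, h', dirDerivMap_apply] at h
    rw [← sub_eq_zero] at h
    rw [← neg_eq_zero, ← h]
    module
  by_contra hne
  -- A nonzero defect would force the tangent space at `x` to be zero, where all derivatives vanish
  -- and the formula is trivial.
  have hZ (v : TangentSpace 𝓘(ℝ, E) x) : v = 0 := by
    obtain ⟨Z, rfl⟩ := exists_section_apply_eq (F := E) E x v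
    exact (smul_eq_zero.1 (key Z)).resolve_left (sub_ne_zero.2 hne)
  apply hne
  simp only [dirDeriv_eq_differential, hZ, map_zero, sub_zero]

end DirDeriv

/-! ### The Jacobiator on a vector space -/

section VectorSpace

variable {W : Type*} [NormedAddCommGroup W] [NormedSpace ℝ W]

lemma contDiffAt_sum_smul {G ι : Type*} [NormedAddCommGroup G] [NormedSpace ℝ G] [Fintype ι]
    {c : ι → ι → W → ℝ} {A : ι → ι → G} {y : W} (hc : ∀ i j, ContDiffAt ℝ ∞ (c i j) y) :
    ContDiffAt ℝ ∞ (fun z => ∑ i, ∑ j, c i j z • A i j) y :=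
  ContDiffAt.sum fun i _ => ContDiffAt.sum fun j _ => (hc i j).smul contDiffAt_const

/-- The bracket of functions on a vector space defined by the field `P` of bilinear forms. -/
def fieldBracket (P : W → (W →L[ℝ] ℝ) →L[ℝ] W) (f g : W → ℝ) (y : W) : ℝ :=
  fderiv ℝ g y (P y (fderiv ℝ f y))

lemma fderiv_fieldBracket {P : W → (W →L[ℝ] ℝ) →L[ℝ] W} {y : W} (hP : DifferentiableAt ℝ P y)
    {f g : W → ℝ} (hf : ContDiffAt ℝ 2 f y) (hg : ContDiffAt ℝ 2 g y) (v : W) :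
    fderiv ℝ (fieldBracket P f g) y v =
      fderiv ℝ (fderiv ℝ g) y v (P y (fderiv ℝ f y)) +
      fderiv ℝ g y (fderiv ℝ P y v (fderiv ℝ f y)) +
      fderiv ℝ g y (P y (fderiv ℝ (fderiv ℝ f) y v)) := by
  have h1 {f : W → ℝ} (hf : ContDiffAt ℝ 2 f y) :
      HasFDerivAt (fderiv ℝ f) (fderiv ℝ (fderiv ℝ f) y) y :=
    ((hf.fderiv_right (m := 1) (by norm_num)).differentiableAt (by norm_num)).hasFDerivAt
  have h := (h1 hg).clm_apply (hP.hasFDerivAt.clm_apply (h1 hf))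
  rw [show fieldBracket P f g = fun z => fderiv ℝ g z (P z (fderiv ℝ f z)) from rfl, h.fderiv]
  simp
  ring

/-- The Jacobiator of an antisymmetric field of bilinear forms is tensorial. -/
lemma fieldBracket_jacobi {P : W → (W →L[ℝ] ℝ) →L[ℝ] W} {y : W} (hP : DifferentiableAt ℝ P y)
    (hPs : ∀ a b : W →L[ℝ] ℝ, b (P y a) = -a (P y b)) {f g h : W → ℝ} (hf : ContDiffAt ℝ 2 f y)
    (hg : ContDiffAt ℝ 2 g y) (hh : ContDiffAt ℝ 2 h y) :
    fieldBracket P f (fieldBracket P g h) y + fieldBracket P g (fieldBracket P h f) y +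
      fieldBracket P h (fieldBracket P f g) y =
    fderiv ℝ h y (fderiv ℝ P y (P y (fderiv ℝ f y)) (fderiv ℝ g y)) +
      fderiv ℝ f y (fderiv ℝ P y (P y (fderiv ℝ g y)) (fderiv ℝ h y)) +
      fderiv ℝ g y (fderiv ℝ P y (P y (fderiv ℝ h y)) (fderiv ℝ f y)) := by
  have key (f g h : W → ℝ) (hg : ContDiffAt ℝ 2 g y) (hh : ContDiffAt ℝ 2 h y) :
      fieldBracket P f (fieldBracket P g h) y =
      fderiv ℝ (fderiv ℝ h) y (P y (fderiv ℝ f y)) (P y (fderiv ℝ g y)) +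
      fderiv ℝ h y (fderiv ℝ P y (P y (fderiv ℝ f y)) (fderiv ℝ g y)) -
      fderiv ℝ (fderiv ℝ g) y (P y (fderiv ℝ f y)) (P y (fderiv ℝ h y)) := by
    rw [fieldBracket, fderiv_fieldBracket hP hg hh, hPs _ (fderiv ℝ h y), sub_eq_add_neg]
  have sym {f : W → ℝ} (hf : ContDiffAt ℝ 2 f y) (v w : W) :
      fderiv ℝ (fderiv ℝ f) y v w = fderiv ℝ (fderiv ℝ f) y w v :=
    (hf.isSymmSndFDerivAt (by simp)) v w
  -- Each function contributes two Hessian terms with opposite signs and exchanged arguments;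
  -- symmetry of second derivatives cancels them.
  rw [key f g h hg hh, key g h f hh hf, key h f g hf hg, sym hf (P y (fderiv ℝ g y)),
    sym hg (P y (fderiv ℝ h y)), sym hh (P y (fderiv ℝ f y))]
  ring

end VectorSpace

/-! ### Bivector fields in coordinates and tensoriality of the Jacobiator -/

section Coordinates

variable {W : Type*} [NormedAddCommGroup W] [NormedSpace ℝ W] [FiniteDimensional ℝ W]
  {H : Type*} [TopologicalSpace H] {I : ModelWithCorners ℝ W H} [I.Boundaryless]
  {P : Type*} [TopologicalSpace P] [ChartedSpace H P] [IsManifold I ∞ P]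

/-- A smooth function read in the chart at `p`. -/
def readInChart (p : P) (f : P → ℝ) : W → ℝ := f ∘ (extChartAt I p).symm

lemma contDiffAt_readInChart (f : C^∞⟮I, P; ℝ⟯) {p q : P} (hq : q ∈ (extChartAt I p).source) :
    ContDiffAt ℝ ∞ (readInChart (I := I) p f) (extChartAt I p q) := by
  rw [← contMDiffAt_iff_contDiffAt]
  have h := (contMDiffOn_extChartAt_symm (I := I) (n := ∞) p).contMDiffAt
    ((isOpen_extChartAt_target (I := I) p).mem_nhds ((extChartAt I p).map_source hq))
  exact f.contMDiff.contMDiffAt.comp _ h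

/-- The derivative at `q` of the chart at `p`. -/
def chartDeriv (p q : P) : TangentSpace I q →L[ℝ] W := mfderiv I 𝓘(ℝ, W) (extChartAt I p) q

lemma exists_chartDeriv_eq {p q : P} (hq : q ∈ (extChartAt I p).source) :
    ∃ L : TangentSpace I q ≃L[ℝ] W, (L : TangentSpace I q →L[ℝ] W) = chartDeriv p q :=
  isInvertible_mfderiv_extChartAt hq

lemma differential_eq_readInChart (f : C^∞⟮I, P; ℝ⟯) {p q : P} (hq : q ∈ (extChartAt I p).source) :
    differential I f q = fderiv ℝ (readInChart (I := I) p f) (extChartAt I p q) ∘L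
      chartDeriv p q := by
  have h1 : (f : P → ℝ) =ᶠ[𝓝 q] readInChart (I := I) p f ∘ extChartAt I p := by
    filter_upwards [(isOpen_extChartAt_source (I := I) p).mem_nhds hq] with z hz
    exact congrArg f ((extChartAt I p).left_inv hz).symm
  rw [differential_congr h1]
  have h2 := ((contDiffAt_readInChart f hq).differentiableAt (by simp)).hasFDerivAt.hasMFDerivAt
  have h3 : MDifferentiableAt I 𝓘(ℝ, W) (extChartAt I p) q :=
    mdifferentiableAt_extChartAt (by simpa using hq)
  exact (h2.comp q h3.hasMFDerivAt).mfderiv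

/-- The global functions `u i` are, around `p`, the coordinates of the chart at `p` in the basis
`e`. -/
def IsCoordinateSystem {ι : Type*} (e : Module.Basis ι ℝ W) (p : P) (u : ι → C^∞⟮I, P; ℝ⟯) : Prop :=
  ∀ i, u i =ᶠ[𝓝 p] fun q => e.coord i (extChartAt I p q)

variable {ι : Type*} [Fintype ι] {e : Module.Basis ι ℝ W} {p : P} {u : ι → C^∞⟮I, P; ℝ⟯}

/-- The expansion df = Σ (∂f/∂u_i) du_i holds on a neighbourhood and not only at `p`, because
equality of germs at `p` persists at nearby points. -/
lemma IsCoordinateSystem.eventually_differential (hu : IsCoordinateSystem e p u)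
    (f : C^∞⟮I, P; ℝ⟯) : ∀ᶠ q in 𝓝 p, differential I f q =
      ∑ i, fderiv ℝ (readInChart (I := I) p f) (extChartAt I p q) (e i) • differential I (u i) q := by
  have h1 : ∀ᶠ q in 𝓝 p, ∀ i, u i =ᶠ[𝓝 q] fun q => e.coord i (extChartAt I p q) :=
    Filter.eventually_all.2 fun i => (hu i).eventually_nhds
  filter_upwards [h1, extChartAt_source_mem_nhds (I := I) p] with q hq hq'
  have h3 : MDifferentiableAt I 𝓘(ℝ, W) (extChartAt I p) q :=
    mdifferentiableAt_extChartAt (by simpa using hq')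
  have h2 (i) : differential I (u i) q =
      (e.coord i).toContinuousLinearMap ∘L chartDeriv p q := by
    rw [differential_congr (hq i)]
    exact ((e.coord i).toContinuousLinearMap.hasFDerivAt.hasMFDerivAt.comp q h3.hasMFDerivAt).mfderiv
  rw [differential_eq_readInChart f hq']
  ext v
  simp only [h2, sum_apply, smul_apply,
    ContinuousLinearMap.comp_apply]
  conv_lhs => rw [← e.sum_repr (chartDeriv p q v), map_sum]
  refine Finset.sum_congr rfl fun i _ => ?_
  rw [map_smul, smul_eq_mul, smul_eq_mul, mul_comm]
  rfl

lemma contMDiffAt_fderiv_readInChart (f : C^∞⟮I, P; ℝ⟯) (p : P) (w : W) :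
    ContMDiffAt I 𝓘(ℝ, ℝ) ∞
      (fun q => fderiv ℝ (readInChart (I := I) p f) (extChartAt I p q) w) p := by
  have h := ((contDiffAt_readInChart f (mem_extChartAt_source (I := I) p)).fderiv_right
    (m := ∞) (by simp)).clm_apply contDiffAt_const (g := fun _ => w)
  exact h.contMDiffAt.comp p contMDiffAt_extChartAt

variable (η : BivectorField I P)

/-- A bivector field in the coordinates `u` around `p`. -/
def coordinateField (e : Module.Basis ι ℝ W) (p : P) (u : ι → C^∞⟮I, P; ℝ⟯) (y : W) :
    (W →L[ℝ] ℝ) →L[ℝ] W :=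
  ∑ i, ∑ j, readInChart (I := I) p (η.bracket (u i) (u j)) y •
    (ContinuousLinearMap.apply ℝ ℝ (e i)).smulRight (e j)

lemma coordinateField_apply (a b : W →L[ℝ] ℝ) (y : W) : b (coordinateField η e p u y a) =
    ∑ i, ∑ j, readInChart (I := I) p (η.bracket (u i) (u j)) y * (a (e i) * b (e j)) := by
  simp [coordinateField]

lemma BivectorField.swap (q : P) (α β : TangentSpace I q →L[ℝ] ℝ) :
    η.toFun q α β = -η.toFun q β α := by
  have h := η.alternating q (α + β)
  simp only [map_add, LinearMap.add_apply, η.alternating] at h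
  linarith

/-- An equality of germs is needed: a bracket must be differentiated once more when it is inserted
in another bracket. -/
lemma IsCoordinateSystem.eventually_bracket (hu : IsCoordinateSystem e p u) (f g : C^∞⟮I, P; ℝ⟯) :
    readInChart (I := I) p (η.bracket f g) =ᶠ[𝓝 (extChartAt I p p)]
      fieldBracket (coordinateField η e p u) (readInChart (I := I) p f)
        (readInChart (I := I) p g) := by
  have ht : Filter.Tendsto (extChartAt I p).symm (𝓝 (extChartAt I p p)) (𝓝 p) := by
    have := continuousAt_extChartAt_symm (I := I) p
    rwa [ContinuousAt, extChartAt_to_inv] at this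
  filter_upwards [ht.eventually (hu.eventually_differential f),
    ht.eventually (hu.eventually_differential g), extChartAt_target_mem_nhds (I := I) p]
    with y hf hg hy
  rw [(extChartAt I p).right_inv hy] at hf hg
  rw [fieldBracket, coordinateField_apply]
  show η.toFun _ (differential I f _) (differential I g _) = _
  rw [hf, hg]
  simp only [map_sum, LinearMap.sum_apply, map_smul, LinearMap.smul_apply, smul_eq_mul]
  simp only [Finset.mul_sum]
  rw [Finset.sum_comm]
  refine Finset.sum_congr rfl fun i _ => Finset.sum_congr rfl fun j _ => ?_
  rw [show readInChart (I := I) p (η.bracket (u i) (u j)) y =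
    η.toFun ((extChartAt I p).symm y) (differential I (u i) _) (differential I (u j) _) from rfl]
  ring

/-- The Jacobiator of a bivector field, as a function. -/
def BivectorField.jacobiator (f g h : C^∞⟮I, P; ℝ⟯) : C^∞⟮I, P; ℝ⟯ :=
  η.bracket f (η.bracket g h) + η.bracket g (η.bracket h f) + η.bracket h (η.bracket f g)

/-- In coordinates the Jacobiator involves only first derivatives of its arguments
(`fieldBracket_jacobi`). It can therefore be tested on any functions whose differentials at `p` are
the given ones. -/
lemma IsCoordinateSystem.jacobiator_congr (hu : IsCoordinateSystem e p u)
    {f g h f' g' h' : C^∞⟮I, P; ℝ⟯} (hf : differential I f p = differential I f' p)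
    (hg : differential I g p = differential I g' p)
    (hh : differential I h p = differential I h' p) :
    η.jacobiator f g h p = η.jacobiator f' g' h' p := by
  set y := extChartAt I p p
  have hp := mem_extChartAt_source (I := I) p
  set Q := coordinateField η e p u with hQ
  have hr (f : C^∞⟮I, P; ℝ⟯) : ContDiffAt ℝ ∞ (readInChart (I := I) p f) y :=
    contDiffAt_readInChart f hp
  have hQd : DifferentiableAt ℝ Q y := by
    have : ContDiffAt ℝ ∞ Q y := contDiffAt_sum_smul fun i j => hr _
    exact this.differentiableAt (by simp)
  have hQs (a b : W →L[ℝ] ℝ) : b (Q y a) = -a (Q y b) := by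
    rw [hQ, coordinateField_apply, coordinateField_apply, Finset.sum_comm, ← Finset.sum_neg_distrib]
    refine Finset.sum_congr rfl fun i _ => ?_
    rw [← Finset.sum_neg_distrib]
    refine Finset.sum_congr rfl fun j _ => ?_
    have : readInChart (I := I) p (η.bracket (u j) (u i)) y =
      -readInChart (I := I) p (η.bracket (u i) (u j)) y := η.swap _ _ _
    rw [this]
    ring
  have hb (f g : C^∞⟮I, P; ℝ⟯) := hu.eventually_bracket η f g
  have hval (f : C^∞⟮I, P; ℝ⟯) : f p = readInChart (I := I) p f y := by
    simp [readInChart, y]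
  have hbb (f g h : C^∞⟮I, P; ℝ⟯) : η.bracket f (η.bracket g h) p =
      fieldBracket Q (readInChart (I := I) p f)
        (fieldBracket Q (readInChart (I := I) p g) (readInChart (I := I) p h)) y := by
    rw [hval, (hb f _).self_of_nhds, fieldBracket, (hb g h).fderiv_eq]
    rfl
  have hd {f f' : C^∞⟮I, P; ℝ⟯} (hf : differential I f p = differential I f' p) :
      fderiv ℝ (readInChart (I := I) p f) y = fderiv ℝ (readInChart (I := I) p f') y := by
    rw [differential_eq_readInChart f hp, differential_eq_readInChart f' hp] at hf
    -- The derivative of the chart is invertible, so it can be cancelled on the right.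
    obtain ⟨L, hL⟩ := exists_chartDeriv_eq hp
    rw [← hL] at hf
    ext v
    have := congrArg (fun A => A (L.symm v)) hf
    simpa [-extChartAt, y] using this
  have h2 : (2 : WithTop ℕ∞) ≤ ∞ := WithTop.coe_le_coe.2 le_top
  have hJ (f g h : C^∞⟮I, P; ℝ⟯) :=
    fieldBracket_jacobi hQd hQs ((hr f).of_le h2) ((hr g).of_le h2) ((hr h).of_le h2)
  have hJ' (f g h : C^∞⟮I, P; ℝ⟯) : η.jacobiator f g h p = _ :=
    (show η.jacobiator f g h p = _ + _ + _ from congrArg₂ (· + ·)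
      (congrArg₂ (· + ·) (hbb f g h) (hbb g h f)) (hbb h f g)).trans (hJ f g h)
  rw [hJ', hJ', hd hf, hd hg, hd hh]

end Coordinates

/-! ### Fibrewise linear and base functions generate the cotangent spaces of V* -/

section Generators

variable {E : Type*} [NormedAddCommGroup E] [NormedSpace ℝ E] [FiniteDimensional ℝ E]
  {M : Type*} [TopologicalSpace M] [T2Space M] [ChartedSpace E M] [IsManifold 𝓘(ℝ, E) ∞ M]
  {F : Type*} [NormedAddCommGroup F] [NormedSpace ℝ F] [FiniteDimensional ℝ F] {V : M → Type*}
  [TopologicalSpace (TotalSpace F V)] [∀ x, AddCommGroup (V x)] [∀ x, Module ℝ (V x)]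
  [∀ x, TopologicalSpace (V x)] [FiberBundle F V] [VectorBundle ℝ F V]
  [ContMDiffVectorBundle ∞ F V 𝓘(ℝ, E)]

local notation "𝓙" => ModelWithCorners.prod 𝓘(ℝ, E) 𝓘(ℝ, F →L[ℝ] ℝ)

/-- The functions on `V*` which are sums of a fibrewise linear function and a base function, as a
linear function of the section and of the function defining them. -/
def generatorFun : (Cₛ^∞⟮𝓘(ℝ, E); F, V⟯ × C^∞⟮𝓘(ℝ, E), M; ℝ⟯) →ₗ[ℝ]
    C^∞⟮𝓙, DualBundle F V; ℝ⟯ where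
  toFun a := linearFun a.1 + baseFun a.2
  map_add' a b := ContMDiffMap.ext fun p => by
    show p.2 (a.1 p.1 + b.1 p.1) + (a.2 p.1 + b.2 p.1) =
      (p.2 (a.1 p.1) + a.2 p.1) + (p.2 (b.1 p.1) + b.2 p.1)
    rw [map_add]
    ring
  map_smul' c a := ContMDiffMap.ext fun p => by
    show p.2 (c • a.1 p.1) + c * a.2 p.1 = c * (p.2 (a.1 p.1) + a.2 p.1)
    rw [map_smul, smul_eq_mul]
    ring

lemma generatorFun_apply (a : Cₛ^∞⟮𝓘(ℝ, E); F, V⟯ × C^∞⟮𝓘(ℝ, E), M; ℝ⟯) (p : DualBundle F V) :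
    generatorFun a p = p.2 (a.1 p.1) + a.2 p.1 := rfl

lemma generatorFun_inl (X : Cₛ^∞⟮𝓘(ℝ, E); F, V⟯) : generatorFun (X, 0) = linearFun X :=
  ContMDiffMap.ext fun p => add_zero (p.2 (X p.1))

lemma generatorFun_inr (f : C^∞⟮𝓘(ℝ, E), M; ℝ⟯) :
    generatorFun ((0 : Cₛ^∞⟮𝓘(ℝ, E); F, V⟯), f) = baseFun f :=
  ContMDiffMap.ext fun p => by
    show p.2 0 + f p.1 = f p.1
    rw [map_zero, zero_add]

/-- Reflexivity of the finite-dimensional space `F`: a linear coordinate on the fibre of V* is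
evaluation at a vector, which then extends to a section. -/
lemma exists_eval_eq (φ : (F →L[ℝ] ℝ) →L[ℝ] ℝ) : ∃ v : F, ∀ ζ : F →L[ℝ] ℝ, φ ζ = ζ v := by
  let ψ : Module.Dual ℝ (Module.Dual ℝ F) :=
    φ.toLinearMap ∘ₗ (LinearMap.toContinuousLinearMap : (F →ₗ[ℝ] ℝ) ≃ₗ[ℝ] F →L[ℝ] ℝ).toLinearMap
  obtain ⟨v, hv⟩ := (Module.bijective_dual_eval ℝ F).2 ψ
  refine ⟨v, fun ζ => ?_⟩
  have h := LinearMap.congr_fun hv ζ.toLinearMap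
  exact (h.trans (congrArg φ (by ext; rfl))).symm

lemma extChartAt_dualBundle (p q : DualBundle F V) :
    extChartAt 𝓙 p q = (extChartAt 𝓘(ℝ, E) p.1 q.1,
      (trivializationAt (F →L[ℝ] ℝ) (fun x => V x →L[ℝ] ℝ) p.1 q).2) := by
  rw [FiberBundle.extChartAt]
  rfl

/-- The trivialization of the dual bundle is the inverse transpose of that of `V`, so a fibre
coordinate on V* is pairing with a section that is constant in the trivialization. -/
lemma trivializationAt_dualBundle (x : M) (q : DualBundle F V)
    (hq : q.1 ∈ (trivializationAt F V x).baseSet) (v : F) :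
    (trivializationAt (F →L[ℝ] ℝ) (fun x => V x →L[ℝ] ℝ) x q).2 v =
      q.2 ((trivializationAt F V x).symm q.1 v) := by
  rw [hom_trivializationAt_apply, ContinuousLinearMap.inCoordinates]
  have h : Trivialization.continuousLinearMapAt ℝ (trivializationAt ℝ (Bundle.Trivial M ℝ) x) q.1 =
      ContinuousLinearMap.id ℝ ℝ := Bundle.Trivial.continuousLinearMapAt_trivialization ℝ M ℝ q.1
  refine (congrArg (fun A : ℝ →L[ℝ] ℝ =>
    A (q.2 (Trivialization.symmL ℝ (trivializationAt F V x) q.1 v))) h).trans ?_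
  exact congrArg q.2 ((trivializationAt F V x).symmL_apply hq v)

/-- Around every point, the linear functions of the coordinates of `V*` are sums of a fibrewise
linear function and a base function. -/
lemma exists_generatorFun_eventuallyEq (p : DualBundle F V) (a : (E × (F →L[ℝ] ℝ)) →L[ℝ] ℝ) :
    ∃ g : Cₛ^∞⟮𝓘(ℝ, E); F, V⟯ × C^∞⟮𝓘(ℝ, E), M; ℝ⟯,
      generatorFun g =ᶠ[𝓝 p] fun q => a (extChartAt 𝓙 p q) := by
  obtain ⟨v, hv⟩ := exists_eval_eq (a ∘L ContinuousLinearMap.inr ℝ E (F →L[ℝ] ℝ))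
  obtain ⟨X, hX⟩ := exists_section_symm (V := V) E p.1 v
  obtain ⟨f, hf⟩ := exists_contMDiffMap_eventuallyEq
    (s := fun x => a (extChartAt 𝓘(ℝ, E) p.1 x, 0)) (chartAt E p.1).open_source
    (mem_chart_source E p.1) (by
      have := (a ∘L ContinuousLinearMap.inl ℝ E (F →L[ℝ] ℝ)).contDiff.contMDiff (n := ∞)
      exact this.comp_contMDiffOn contMDiffOn_extChartAt)
  refine ⟨(X, f), ?_⟩
  have hc : Filter.Tendsto (π (F →L[ℝ] ℝ) (fun x => V x →L[ℝ] ℝ)) (𝓝 p) (𝓝 p.1) :=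
    (FiberBundle.continuous_proj (F →L[ℝ] ℝ) (fun x => V x →L[ℝ] ℝ)).tendsto p
  filter_upwards [hc.eventually hX, hc.eventually hf, hc.eventually
    ((trivializationAt F V p.1).open_baseSet.mem_nhds (FiberBundle.mem_baseSet_trivializationAt' _))]
    with q h1 h2 h3
  -- The base component of `a` is matched by the function `f` and the fibre component by the section
  -- `X`.
  have h4 : a (extChartAt 𝓙 p q) = a (extChartAt 𝓘(ℝ, E) p.1 q.1, 0) +
      (a ∘L ContinuousLinearMap.inr ℝ E (F →L[ℝ] ℝ)) (extChartAt 𝓙 p q).2 := by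
    rw [ContinuousLinearMap.comp_apply, ← map_add, extChartAt_dualBundle]
    simp only [ContinuousLinearMap.inr_apply, Prod.mk_add_mk, add_zero, zero_add]
  rw [h4, hv, generatorFun_apply, extChartAt_dualBundle, trivializationAt_dualBundle _ _ h3, h1, h2,
    add_comm]

/-- A covector read in the chart is a linear function of the coordinates, and such a function has
the germ of a generator. -/
lemma differential_generatorFun_surjective (p : DualBundle F V) :
    Function.Surjective (differentialLinear p ∘ₗ (generatorFun (E := E) (F := F) (V := V))) := by
  intro α
  obtain ⟨L, hL⟩ := exists_chartDeriv_eq (mem_extChartAt_source (I := 𝓙) p)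
  obtain ⟨g, hg⟩ := exists_generatorFun_eventuallyEq p (α ∘L (L.symm : (E × (F →L[ℝ] ℝ)) →L[ℝ] TangentSpace 𝓙 p))
  refine ⟨g, ?_⟩
  show differential 𝓙 (generatorFun g) p = α
  rw [differential_congr hg]
  have h := (mdifferentiableAt_extChartAt (I := 𝓙) (mem_chart_source _ p)).hasMFDerivAt
  refine ((ContinuousLinearMap.hasFDerivAt _).hasMFDerivAt.comp p h).mfderiv.trans ?_
  change (_ ∘L _) ∘L chartDeriv p p = α
  rw [← hL]
  ext v
  exact congrArg α (L.symm_apply_apply v)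

lemma exists_isCoordinateSystem {ι : Type*} (e : Module.Basis ι ℝ (E × (F →L[ℝ] ℝ)))
    (p : DualBundle F V) :
    ∃ g : ι → Cₛ^∞⟮𝓘(ℝ, E); F, V⟯ × C^∞⟮𝓘(ℝ, E), M; ℝ⟯,
      IsCoordinateSystem e p fun i => generatorFun (g i) := by
  choose g hg using fun i => exists_generatorFun_eventuallyEq p
    (e.coord i).toContinuousLinearMap
  exact ⟨g, hg⟩

end Generators

/-! ### The semidirect product bracket and its dependence on differentials -/

section LinearPoisson

variable {E : Type*} [NormedAddCommGroup E] [NormedSpace ℝ E] [FiniteDimensional ℝ E]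
  {M : Type*} [TopologicalSpace M] [T2Space M] [ChartedSpace E M] [IsManifold 𝓘(ℝ, E) ∞ M]
  {F : Type*} [NormedAddCommGroup F] [NormedSpace ℝ F] [FiniteDimensional ℝ F] {V : M → Type*}
  [TopologicalSpace (TotalSpace F V)] [∀ x, AddCommGroup (V x)] [∀ x, Module ℝ (V x)]
  [∀ x, TopologicalSpace (V x)] [FiberBundle F V] [VectorBundle ℝ F V]
  [ContMDiffVectorBundle ∞ F V 𝓘(ℝ, E)]

local notation "𝓙" => ModelWithCorners.prod 𝓘(ℝ, E) 𝓘(ℝ, F →L[ℝ] ℝ)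

variable {ρ : HomToTangent E F V}
  {br : Cₛ^∞⟮𝓘(ℝ, E); F, V⟯ → Cₛ^∞⟮𝓘(ℝ, E); F, V⟯ → Cₛ^∞⟮𝓘(ℝ, E); F, V⟯}

namespace IsLieAlgebroid

/-- The semidirect product bracket on `Γ(V) × C^∞(M)`. -/
def generatorBracket (h : IsLieAlgebroid ρ br) :
    (Cₛ^∞⟮𝓘(ℝ, E); F, V⟯ × C^∞⟮𝓘(ℝ, E), M; ℝ⟯) →ₗ[ℝ]
    (Cₛ^∞⟮𝓘(ℝ, E); F, V⟯ × C^∞⟮𝓘(ℝ, E), M; ℝ⟯) →ₗ[ℝ]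
    (Cₛ^∞⟮𝓘(ℝ, E); F, V⟯ × C^∞⟮𝓘(ℝ, E), M; ℝ⟯) :=
  LinearMap.mk₂ ℝ
    (fun a b => (br a.1 b.1, dirDerivMap (ρ.map a.1) b.2 - dirDerivMap (ρ.map b.1) a.2))
    (fun a b c => Prod.ext (h.add_left _ _ _) (by
      simp only [Prod.fst_add, Prod.snd_add, HomToTangent.map_add, dirDerivMap_add_left,
        dirDerivMap_add_right]
      abel))
    (fun r a b => Prod.ext (h.smul_left _ _ _) (by
      simp only [Prod.smul_fst, Prod.smul_snd, HomToTangent.map_smul, dirDerivMap_smul_left,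
        dirDerivMap_smul_right, smul_sub]))
    (fun a b c => Prod.ext (h.add_right _ _ _) (by
      simp only [Prod.fst_add, Prod.snd_add, HomToTangent.map_add, dirDerivMap_add_left,
        dirDerivMap_add_right]
      abel))
    (fun r a b => Prod.ext (h.smul_right _ _ _) (by
      simp only [Prod.smul_fst, Prod.smul_snd, HomToTangent.map_smul, dirDerivMap_smul_left,
        dirDerivMap_smul_right, smul_sub]))

variable (h : IsLieAlgebroid ρ br)

lemma generatorBracket_apply (a b : Cₛ^∞⟮𝓘(ℝ, E); F, V⟯ × C^∞⟮𝓘(ℝ, E), M; ℝ⟯) :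
    h.generatorBracket a b =
      (br a.1 b.1, dirDerivMap (ρ.map a.1) b.2 - dirDerivMap (ρ.map b.1) a.2) := rfl

lemma generatorBracket_self (a : Cₛ^∞⟮𝓘(ℝ, E); F, V⟯ × C^∞⟮𝓘(ℝ, E), M; ℝ⟯) :
    h.generatorBracket a a = 0 := Prod.ext (h.self _) (sub_self _)

lemma generatorBracket_swap (a b : Cₛ^∞⟮𝓘(ℝ, E); F, V⟯ × C^∞⟮𝓘(ℝ, E), M; ℝ⟯) :
    h.generatorBracket b a = -h.generatorBracket a b := by
  have e := h.generatorBracket_self (a + b)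
  simp only [map_add, LinearMap.add_apply, h.generatorBracket_self, zero_add, add_zero] at e
  exact eq_neg_of_add_eq_zero_left (by simpa [add_comm] using e)

/-- The section component is the Jacobi identity of `br`. The function component says that Γ(V) acts
on functions through the anchor, which is a homomorphism to vector fields. -/
lemma generatorBracket_jacobi (a b c : Cₛ^∞⟮𝓘(ℝ, E); F, V⟯ × C^∞⟮𝓘(ℝ, E), M; ℝ⟯) :
    h.generatorBracket a (h.generatorBracket b c) + h.generatorBracket b (h.generatorBracket c a) +
      h.generatorBracket c (h.generatorBracket a b) = 0 := by
  refine Prod.ext (h.jacobi _ _ _) ?_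
  have hs (X : SmoothVectorField E M) (f g : C^∞⟮𝓘(ℝ, E), M; ℝ⟯) :
      dirDerivMap X (f - g) = dirDerivMap X f - dirDerivMap X g := by
    rw [eq_sub_iff_add_eq, ← dirDerivMap_add_right, sub_add_cancel]
  simp only [generatorBracket_apply, Prod.snd_add, h.anchor, dirDerivMap_lieBracketField, hs,
    Prod.snd_zero]
  abel

lemma bracket_swap (h : IsLieAlgebroid ρ br) (X Y : Cₛ^∞⟮𝓘(ℝ, E); F, V⟯) : br Y X = -br X Y :=
  congrArg Prod.fst (h.generatorBracket_swap (X, 0) (Y, 0))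

end IsLieAlgebroid

/-- A fibrewise linear function, as a linear function of the section. -/
def linearFunLinear : Cₛ^∞⟮𝓘(ℝ, E); F, V⟯ →ₗ[ℝ] C^∞⟮𝓙, DualBundle F V; ℝ⟯ where
  toFun := linearFun
  map_add' X Y := ContMDiffMap.ext fun p => map_add p.2 (X p.1) (Y p.1)
  map_smul' c X := ContMDiffMap.ext fun p => map_smul p.2 c (X p.1)

lemma linearFun_funSMul (f : C^∞⟮𝓘(ℝ, E), M; ℝ⟯) (X : Cₛ^∞⟮𝓘(ℝ, E); F, V⟯) :
    linearFun (funSMul f X) = baseFun f * linearFun X :=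
  ContMDiffMap.ext fun p => map_smul p.2 (f p.1) (X p.1)

lemma differential_baseFun (f : C^∞⟮𝓘(ℝ, E), M; ℝ⟯) (p : DualBundle F V) :
    differential 𝓙 (baseFun (F := F) (V := V) f) p = differential 𝓘(ℝ, E) f p.1 ∘L
      mfderiv 𝓙 𝓘(ℝ, E) (π (F →L[ℝ] ℝ) fun x => V x →L[ℝ] ℝ) p :=
  differential_comp f ((Bundle.contMDiff_proj (n := ∞) (IB := 𝓘(ℝ, E))
    (fun x => V x →L[ℝ] ℝ)).mdifferentiable (by simp) p)

/-- The differential of the projection `V* → M` is surjective. -/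
lemma exists_mfderiv_proj_eq (p : DualBundle F V) (v : TangentSpace 𝓘(ℝ, E) p.1) :
    ∃ w : TangentSpace 𝓙 p,
      mfderiv 𝓙 𝓘(ℝ, E) (π (F →L[ℝ] ℝ) fun x => V x →L[ℝ] ℝ) p w = v := by
  obtain ⟨x, ξ⟩ := p
  -- A section of V* through the point splits the projection, so its derivative provides a lift of
  -- `v`.
  obtain ⟨s, hs⟩ := exists_section_apply_eq (F := F →L[ℝ] ℝ) (V := fun x => V x →L[ℝ] ℝ) E x ξ
  subst hs
  have h1 : MDifferentiableAt 𝓘(ℝ, E) 𝓙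
      (fun x => TotalSpace.mk' (F →L[ℝ] ℝ) (E := fun x => V x →L[ℝ] ℝ) x (s x)) x :=
    s.mdifferentiableAt
  have h2 := (Bundle.contMDiff_proj (n := ∞) (IB := 𝓘(ℝ, E)) (F := F →L[ℝ] ℝ)
    (fun x => V x →L[ℝ] ℝ)).mdifferentiable (by simp) (⟨x, s x⟩ : DualBundle F V)
  have h3 := HasMFDerivAt.comp (I' := 𝓙) x h2.hasMFDerivAt h1.hasMFDerivAt
  refine ⟨mfderiv 𝓘(ℝ, E) 𝓙 (fun x => (⟨x, s x⟩ : DualBundle F V)) x v, ?_⟩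
  exact congrArg (fun A : TangentSpace 𝓘(ℝ, E) x →L[ℝ] TangentSpace 𝓘(ℝ, E) x => A v)
    (h3.mfderiv.symm.trans (hasMFDerivAt_id x).mfderiv)

/-- The fibres carry no norm, so separation by functionals is transported from the model fibre. -/
lemma exists_dual_ne_zero {G F : Type*} [AddCommGroup G] [Module ℝ G] [TopologicalSpace G]
    [NormedAddCommGroup F] [NormedSpace ℝ F] (e : G ≃L[ℝ] F) {v : G} (hv : v ≠ 0) :
    ∃ ζ : G →L[ℝ] ℝ, ζ v ≠ 0 := by
  obtain ⟨f, hf⟩ := SeparatingDual.exists_ne_zero (R := ℝ) (x := e v) (by simpa using hv)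
  exact ⟨f ∘L (e : G →L[ℝ] F), hf⟩

/-- The affine line `t ↦ ξ + t ζ` in a fibre of `V*` is differentiable. -/
lemma mdifferentiableAt_line (x : M) (ξ ζ : V x →L[ℝ] ℝ) :
    MDifferentiableAt 𝓘(ℝ, ℝ) 𝓙 (fun t : ℝ => (⟨x, ξ + t • ζ⟩ : DualBundle F V)) 0 := by
  refine ContMDiffAt.mdifferentiableAt (n := ∞) ?_ (by simp)
  rw [Bundle.contMDiffAt_totalSpace]
  refine ⟨contMDiffAt_const, ?_⟩
  let L := (trivializationAt (F →L[ℝ] ℝ) (fun x => V x →L[ℝ] ℝ) x).linearEquivAt ℝ x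
    (FiberBundle.mem_baseSet_trivializationAt' x)
  have : ∀ t : ℝ, L (ξ + t • ζ) = L ξ + t • L ζ := fun t => by rw [map_add, map_smul]
  refine ContMDiffAt.congr_of_eventuallyEq (f := fun t : ℝ => L ξ + t • L ζ) ?_
    (.of_forall fun t => ?_)
  · rw [contMDiffAt_iff_contDiffAt]
    fun_prop
  · exact this t

/-- Along the line ξ + tζ in the fibre the generator is affine with slope ζ(X), X being its section.
If X were nonzero at the base point, some ζ would give a nonzero vertical derivative. -/
lemma eq_zero_of_differential_eq_zero {a : Cₛ^∞⟮𝓘(ℝ, E); F, V⟯ × C^∞⟮𝓘(ℝ, E), M; ℝ⟯}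
    {p : DualBundle F V} (ha : differential 𝓙 (generatorFun a) p = 0) : a.1 p.1 = 0 := by
  obtain ⟨x, ξ⟩ := p
  by_contra hne
  obtain ⟨ζ, hζ⟩ := exists_dual_ne_zero ((trivializationAt F V x).continuousLinearEquivAt ℝ x
    (FiberBundle.mem_baseSet_trivializationAt' x)) hne
  have h1 := mdifferentiableAt_line (E := E) (F := F) x ξ ζ
  have h0 : (⟨x, ξ + (0 : ℝ) • ζ⟩ : DualBundle F V) = ⟨x, ξ⟩ := by simp
  have h2 := differential_comp (generatorFun a) h1
  rw [h0, ha] at h2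
  have h3 : HasFDerivAt (fun t : ℝ => (ξ + t • ζ) (a.1 x) + a.2 x)
      (ContinuousLinearMap.toSpanSingleton ℝ (ζ (a.1 x))) 0 := by
    have : HasDerivAt (fun t : ℝ => (ξ (a.1 x) + t * ζ (a.1 x)) + a.2 x) (ζ (a.1 x)) 0 := by
      simpa using (((hasDerivAt_id (0 : ℝ)).mul_const (ζ (a.1 x))).const_add (ξ (a.1 x))).add_const
        (a.2 x)
    exact this.hasFDerivAt
  have h4 := h3.hasMFDerivAt.mfderiv.symm.trans h2
  have h5 := congrArg (fun A : ℝ →L[ℝ] ℝ => A 1) h4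
  apply hζ
  simpa using h5.trans (rfl : _ = (0 : ℝ))

namespace IsLieAlgebroid

variable (h : IsLieAlgebroid ρ br)

/-- The derivative of a linear function whose section vanishes at the base point. -/
lemma differential_linearFun_apply (h : IsLieAlgebroid ρ br) (X Y : Cₛ^∞⟮𝓘(ℝ, E); F, V⟯) {p : DualBundle F V}
    (hX : X p.1 = 0) {w : TangentSpace 𝓙 p}
    (hw : mfderiv 𝓙 𝓘(ℝ, E) (π (F →L[ℝ] ℝ) fun x => V x →L[ℝ] ℝ) p w = ρ.map Y p.1) :
    differential 𝓙 (linearFun X) p w = p.2 (br Y X p.1) := by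
  obtain ⟨n, ψ, a, Z, hψ, ha, hsum⟩ := exists_funSMul_eq_sum X hX
  -- Since `X` vanishes at the base point and `ψ` is 1 there, replacing `X` by `ψ X` changes neither
  -- the bracket nor, below, the differential.
  have h1 : br Y X p.1 = ∑ i, dirDeriv (ρ.map Y) (a i) p.1 • Z i p.1 := by
    have hb : br Y X p.1 = br Y (funSMul ψ X) p.1 := by
      rw [h.leibniz, hψ, hX, smul_zero, add_zero, one_smul]
    let B : Cₛ^∞⟮𝓘(ℝ, E); F, V⟯ →+ Cₛ^∞⟮𝓘(ℝ, E); F, V⟯ := AddMonoidHom.mk' (br Y) (h.add_right Y)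
    have hB : br Y (∑ i, funSMul (a i) (Z i)) = ∑ i, br Y (funSMul (a i) (Z i)) :=
      map_sum B _ _
    rw [hb, hsum, hB, ← ContMDiffSection.coeAddHom_apply, map_sum, Finset.sum_apply]
    refine Finset.sum_congr rfl fun i _ => ?_
    rw [ContMDiffSection.coeAddHom_apply, h.leibniz, ha, zero_smul, zero_add]
  have h2 : differential 𝓙 (linearFun X) p =
      ∑ i, p.2 (Z i p.1) • differential 𝓙 (baseFun (F := F) (V := V) (a i)) p := by
    have e1 : differential 𝓙 (linearFun (funSMul ψ X)) p = differential 𝓙 (linearFun X) p := by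
      have hb : baseFun ψ p = 1 := hψ
      have hl : linearFun X p = 0 := (congrArg p.2 hX).trans (map_zero p.2)
      rw [linearFun_funSMul, differential_mul, hb, hl, one_smul, zero_smul, add_zero]
    have e2 : differentialLinear p (linearFunLinear (∑ i, funSMul (a i) (Z i))) =
        ∑ i, differentialLinear p (linearFunLinear (funSMul (a i) (Z i))) := by
      rw [map_sum, map_sum]
    rw [← e1, hsum]
    refine e2.trans (Finset.sum_congr rfl fun i _ => ?_)
    show differential 𝓙 (linearFun (funSMul (a i) (Z i))) p = _
    have hb : baseFun (a i) p = 0 := ha i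
    have hl : linearFun (Z i) p = p.2 (Z i p.1) := rfl
    rw [linearFun_funSMul, differential_mul, hb, hl, zero_smul, zero_add]
  rw [h1, h2, map_sum, sum_apply]
  refine Finset.sum_congr rfl fun i _ => ?_
  rw [smul_apply, map_smul, differential_baseFun, ContinuousLinearMap.comp_apply, hw,
    dirDeriv_eq_differential, smul_eq_mul, smul_eq_mul, mul_comm]

/-- This makes the bivector well defined. The section X of `a` vanishes at the base point. Let w be
a tangent vector over ρ(Y), with Y the section of `b`. Then the bracket at `p` is minus the
differential of the generator of `a` on w: the linear part gives ⟨p, [Y, X]⟩, the base part gives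
the derivative of the function of `a` along ρ(Y), and the term in ρ(X) is zero. -/
lemma generatorFun_generatorBracket_eq_zero
    {a : Cₛ^∞⟮𝓘(ℝ, E); F, V⟯ × C^∞⟮𝓘(ℝ, E), M; ℝ⟯} {p : DualBundle F V}
    (ha : differential 𝓙 (generatorFun a) p = 0)
    (b : Cₛ^∞⟮𝓘(ℝ, E); F, V⟯ × C^∞⟮𝓘(ℝ, E), M; ℝ⟯) :
    generatorFun (h.generatorBracket a b) p = 0 := by
  have hX := eq_zero_of_differential_eq_zero ha
  obtain ⟨w, hw⟩ := exists_mfderiv_proj_eq p (ρ.map b.1 p.1)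
  have h1 := congrArg (fun A => A w) ha
  have h2 : differential 𝓙 (generatorFun a) p =
    differential 𝓙 (linearFun a.1) p + differential 𝓙 (baseFun (F := F) (V := V) a.2) p :=
      differential_add _ _ p
  simp only [h2, add_apply, h.differential_linearFun_apply a.1 b.1 hX hw, differential_baseFun,
    ContinuousLinearMap.comp_apply, hw] at h1
  rw [generatorFun_apply, generatorBracket_apply]
  show p.2 (br a.1 b.1 p.1) + (dirDeriv (ρ.map a.1) b.2 p.1 - dirDeriv (ρ.map b.1) a.2 p.1) = 0
  have h3 : dirDeriv (ρ.map a.1) b.2 p.1 = 0 := by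
    have : ρ.map a.1 p.1 = 0 := (congrArg (ρ p.1) hX).trans (map_zero _)
    rw [dirDeriv_eq_differential, this, map_zero]
  rw [h3, h.bracket_swap b.1 a.1, ContMDiffSection.coe_neg, Pi.neg_apply, map_neg]
  have h4 : p.2 (br b.1 a.1 p.1) + dirDeriv (ρ.map b.1) a.2 p.1 = 0 := h1
  linarith

end IsLieAlgebroid

end LinearPoisson

/-! ### Existence, uniqueness and functoriality of the linear Poisson structure -/

section LinearPoisson

variable {E : Type*} [NormedAddCommGroup E] [NormedSpace ℝ E] [FiniteDimensional ℝ E]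
  {M : Type*} [TopologicalSpace M] [T2Space M] [ChartedSpace E M] [IsManifold 𝓘(ℝ, E) ∞ M]
  {F : Type*} [NormedAddCommGroup F] [NormedSpace ℝ F] [FiniteDimensional ℝ F] {V : M → Type*}
  [TopologicalSpace (TotalSpace F V)] [∀ x, AddCommGroup (V x)] [∀ x, Module ℝ (V x)]
  [∀ x, TopologicalSpace (V x)] [FiberBundle F V] [VectorBundle ℝ F V]
  [ContMDiffVectorBundle ∞ F V 𝓘(ℝ, E)]

local notation "𝓙" => ModelWithCorners.prod 𝓘(ℝ, E) 𝓘(ℝ, F →L[ℝ] ℝ)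

variable {ρ : HomToTangent E F V}
  {br : Cₛ^∞⟮𝓘(ℝ, E); F, V⟯ → Cₛ^∞⟮𝓘(ℝ, E); F, V⟯ → Cₛ^∞⟮𝓘(ℝ, E); F, V⟯}

lemma dirDerivMap_zero_right (X : SmoothVectorField E M) : dirDerivMap X 0 = 0 := by
  simpa using dirDerivMap_smul_right 0 X 0

lemma IsLieAlgebroid.bracket_zero_right (h : IsLieAlgebroid ρ br) (X : Cₛ^∞⟮𝓘(ℝ, E); F, V⟯) :
    br X 0 = 0 := by
  simpa using h.smul_right 0 X 0

/-- A linear choice of a generator with a given differential at `p`. -/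
def generatorLift (p : DualBundle F V) : (TangentSpace 𝓙 p →L[ℝ] ℝ) →ₗ[ℝ]
    (Cₛ^∞⟮𝓘(ℝ, E); F, V⟯ × C^∞⟮𝓘(ℝ, E), M; ℝ⟯) :=
  (LinearMap.exists_rightInverse_of_surjective _
    (LinearMap.range_eq_top.2 (differential_generatorFun_surjective p))).choose

lemma differential_generatorLift (p : DualBundle F V) (α : TangentSpace 𝓙 p →L[ℝ] ℝ) :
    differential 𝓙 (generatorFun (generatorLift p α)) p = α :=
  LinearMap.congr_fun (LinearMap.exists_rightInverse_of_surjective _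
    (LinearMap.range_eq_top.2 (differential_generatorFun_surjective p))).choose_spec α

/-- The evaluation of smooth functions at a point. -/
def evalLinear (p : DualBundle F V) : C^∞⟮𝓙, DualBundle F V; ℝ⟯ →ₗ[ℝ] ℝ where
  toFun f := f p
  map_add' _ _ := rfl
  map_smul' _ _ := rfl

namespace IsLieAlgebroid

/-- The linear Poisson bivector at a point of `V*`. -/
def poissonForm (h : IsLieAlgebroid ρ br) (p : DualBundle F V) : (TangentSpace 𝓙 p →L[ℝ] ℝ) →ₗ[ℝ]
    (TangentSpace 𝓙 p →L[ℝ] ℝ) →ₗ[ℝ] ℝ :=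
  (h.generatorBracket.compl₁₂ (generatorLift p) (generatorLift p)).compr₂
    (evalLinear p ∘ₗ generatorFun)

variable (h : IsLieAlgebroid ρ br)

lemma poissonForm_apply (p : DualBundle F V) (α β : TangentSpace 𝓙 p →L[ℝ] ℝ) :
    h.poissonForm p α β =
      generatorFun (h.generatorBracket (generatorLift p α) (generatorLift p β)) p := rfl

lemma generatorFun_generatorBracket_congr
    {a a' : Cₛ^∞⟮𝓘(ℝ, E); F, V⟯ × C^∞⟮𝓘(ℝ, E), M; ℝ⟯} {p : DualBundle F V}
    (ha : differential 𝓙 (generatorFun a) p = differential 𝓙 (generatorFun a') p)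
    (b : Cₛ^∞⟮𝓘(ℝ, E); F, V⟯ × C^∞⟮𝓘(ℝ, E), M; ℝ⟯) :
    generatorFun (h.generatorBracket a b) p = generatorFun (h.generatorBracket a' b) p := by
  have h0 : differential 𝓙 (generatorFun (a - a')) p = 0 := by
    have h1 : (differentialLinear p ∘ₗ generatorFun) (a - a') = 0 := by
      rw [map_sub, sub_eq_zero]
      exact ha
    exact h1
  have h2 := h.generatorFun_generatorBracket_eq_zero h0 b
  rw [map_sub, LinearMap.sub_apply, map_sub] at h2
  exact sub_eq_zero.1 h2

/-- The chosen lifts may be replaced by any generators with the same differentials: this is done in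
the first slot directly, and in the second after a swap. -/
lemma poissonForm_differential (p : DualBundle F V)
    (a b : Cₛ^∞⟮𝓘(ℝ, E); F, V⟯ × C^∞⟮𝓘(ℝ, E), M; ℝ⟯) :
    h.poissonForm p (differential 𝓙 (generatorFun a) p) (differential 𝓙 (generatorFun b) p) =
      generatorFun (h.generatorBracket a b) p := by
  have hneg (c : Cₛ^∞⟮𝓘(ℝ, E); F, V⟯ × C^∞⟮𝓘(ℝ, E), M; ℝ⟯) :
      generatorFun (-c) p = -generatorFun c p := by rw [map_neg]; rfl
  rw [poissonForm_apply, h.generatorFun_generatorBracket_congr (differential_generatorLift p _),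
    h.generatorBracket_swap _ a, hneg,
    h.generatorFun_generatorBracket_congr (differential_generatorLift p _),
    h.generatorBracket_swap a, hneg, neg_neg]

/-- The linear Poisson bivector field on `V*`. -/
def poissonBivector : BivectorField 𝓙 (DualBundle F V) where
  toFun := h.poissonForm
  alternating p α := by
    rw [poissonForm_apply, generatorBracket_self, map_zero]
    rfl
  smooth f g p := by
    let e := Module.finBasis ℝ (E × (F →L[ℝ] ℝ))
    obtain ⟨u, hu⟩ := exists_isCoordinateSystem (V := V) e p
    -- The lifts are chosen point by point with no regularity in the point. Smoothness is read off
    -- from the expansion in coordinate generators, whose mutual brackets are again generators.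
    have h1 : ContMDiffAt 𝓙 𝓘(ℝ, ℝ) ∞ (fun q => ∑ i, ∑ j,
        (fderiv ℝ (readInChart (I := 𝓙) p f) (extChartAt 𝓙 p q) (e i) *
          (fderiv ℝ (readInChart (I := 𝓙) p g) (extChartAt 𝓙 p q) (e j) *
          generatorFun (h.generatorBracket (u i) (u j)) q))) p :=
      contMDiffAt_finsetSum fun i _ => contMDiffAt_finsetSum fun j _ =>
        (contMDiffAt_fderiv_readInChart f p (e i)).mul
          ((contMDiffAt_fderiv_readInChart g p (e j)).mul (generatorFun _).contMDiff.contMDiffAt)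
    refine h1.congr_of_eventuallyEq ?_
    filter_upwards [hu.eventually_differential f, hu.eventually_differential g] with q hf hg
    rw [hf, hg]
    simp only [map_sum, LinearMap.sum_apply, map_smul, LinearMap.smul_apply, smul_eq_mul,
      h.poissonForm_differential, Finset.mul_sum]
    rw [Finset.sum_comm]
    exact Finset.sum_congr rfl fun i _ => Finset.sum_congr rfl fun j _ => by ring

lemma poissonBivector_bracket (a b : Cₛ^∞⟮𝓘(ℝ, E); F, V⟯ × C^∞⟮𝓘(ℝ, E), M; ℝ⟯) :
    h.poissonBivector.bracket (generatorFun a) (generatorFun b) =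
      generatorFun (h.generatorBracket a b) :=
  ContMDiffMap.ext fun p => h.poissonForm_differential p a b

/-- The linear Poisson structure on `V*` of a Lie algebroid. -/
def poissonStructure : PoissonStructure 𝓙 (DualBundle F V) where
  toBivectorField := h.poissonBivector
  jacobi f g k := ContMDiffMap.ext fun p => by
    obtain ⟨u, hu⟩ := exists_isCoordinateSystem (V := V) (Module.finBasis ℝ (E × (F →L[ℝ] ℝ))) p
    -- By tensoriality, each of the three functions is replaced by a generator with the same
    -- differential at `p`.
    have hd (f : C^∞⟮𝓙, DualBundle F V; ℝ⟯) :=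
      (differential_generatorLift p (differential 𝓙 f p)).symm
    refine (hu.jacobiator_congr h.poissonBivector (hd f) (hd g) (hd k)).trans ?_
    rw [BivectorField.jacobiator]
    simp only [poissonBivector_bracket, ← map_add, generatorBracket_jacobi, map_zero]

lemma isLinearPoisson_poissonStructure : IsLinearPoisson ρ br h.poissonStructure where
  linear_linear X Y := by
    refine (congrArg₂ h.poissonBivector.bracket (generatorFun_inl X).symm
      (generatorFun_inl Y).symm).trans ((h.poissonBivector_bracket _ _).trans ?_)
    rw [generatorBracket_apply, dirDerivMap_zero_right, dirDerivMap_zero_right, sub_zero,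
      generatorFun_inl]
  linear_base X f p := by
    refine (DFunLike.congr_fun ((congrArg₂ h.poissonBivector.bracket (generatorFun_inl X).symm
      (generatorFun_inr f).symm).trans (h.poissonBivector_bracket _ _)) p).trans ?_
    rw [generatorBracket_apply, dirDerivMap_zero_right, sub_zero, h.bracket_zero_right,
      generatorFun_inr]
    rfl
  base_base f g := by
    refine (congrArg₂ h.poissonBivector.bracket (generatorFun_inr f).symm
      (generatorFun_inr g).symm).trans ((h.poissonBivector_bracket _ _).trans ?_)
    have h0 : ρ.map 0 = 0 := ContMDiffSection.ext fun x => map_zero (ρ x)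
    have h1 (k : C^∞⟮𝓘(ℝ, E), M; ℝ⟯) : dirDerivMap (ρ.map 0) k = 0 := by
      rw [h0]
      exact ContMDiffMap.ext fun x => map_zero (differential 𝓘(ℝ, E) k x)
    rw [generatorBracket_apply, h.bracket_zero_right, h1, h1, sub_zero]
    exact map_zero generatorFun

end IsLieAlgebroid

/-- The defining identities, extended bilinearly, fix the bivector on all differentials of
generators, hence on all covectors. -/
lemma IsLinearPoisson.bracket_generatorFun (h : IsLieAlgebroid ρ br)
    {η : PoissonStructure 𝓙 (DualBundle F V)} (hη : IsLinearPoisson ρ br η)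
    (a b : Cₛ^∞⟮𝓘(ℝ, E); F, V⟯ × C^∞⟮𝓘(ℝ, E), M; ℝ⟯) (p : DualBundle F V) :
    η.toFun p (differential 𝓙 (generatorFun a) p) (differential 𝓙 (generatorFun b) p) =
      generatorFun (h.generatorBracket a b) p := by
  have h1 (a : Cₛ^∞⟮𝓘(ℝ, E); F, V⟯ × C^∞⟮𝓘(ℝ, E), M; ℝ⟯) : differential 𝓙 (generatorFun a) p =
    differential 𝓙 (linearFun a.1) p + differential 𝓙 (baseFun (F := F) (V := V) a.2) p :=
      differential_add _ _ p
  have e1 : η.toFun p (differential 𝓙 (linearFun a.1) p) (differential 𝓙 (linearFun b.1) p) =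
      p.2 (br a.1 b.1 p.1) := DFunLike.congr_fun (hη.linear_linear a.1 b.1) p
  have e2 (a b : Cₛ^∞⟮𝓘(ℝ, E); F, V⟯ × C^∞⟮𝓘(ℝ, E), M; ℝ⟯) :
      η.toFun p (differential 𝓙 (linearFun a.1) p)
      (differential 𝓙 (baseFun (F := F) (V := V) b.2) p) = dirDeriv (ρ.map a.1) b.2 p.1 :=
    hη.linear_base a.1 b.2 p
  have e3 : η.toFun p (differential 𝓙 (baseFun (F := F) (V := V) a.2) p)
      (differential 𝓙 (baseFun (F := F) (V := V) b.2) p) = 0 :=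
    DFunLike.congr_fun (hη.base_base a.2 b.2) p
  rw [h1, h1, generatorFun_apply, h.generatorBracket_apply]
  simp only [map_add, LinearMap.add_apply, e1, e2, e3]
  -- The identities give the linear-base bracket in one order only; antisymmetry supplies the other,
  -- with its sign.
  rw [η.toBivectorField.swap, e2]
  show _ = p.2 (br a.1 b.1 p.1) + (dirDeriv (ρ.map a.1) b.2 p.1 - dirDeriv (ρ.map b.1) a.2 p.1)
  ring

theorem IsLieAlgebroid.existsUnique_isLinearPoisson (h : IsLieAlgebroid ρ br) :
    ∃! η : PoissonStructure 𝓙 (DualBundle F V), IsLinearPoisson ρ br η := by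
  refine ⟨h.poissonStructure, h.isLinearPoisson_poissonStructure, fun η hη => ?_⟩
  apply PoissonStructure.ext
  funext p
  refine LinearMap.ext₂ fun α β => ?_
  rw [← differential_generatorLift p α, ← differential_generatorLift p β,
    hη.bracket_generatorFun h, h.isLinearPoisson_poissonStructure.bracket_generatorFun h]

/-- Pairing a transposed covector with X is pairing the covector with ρX, so generators pull back to
generators. -/
lemma HomToTangent.generatorFun_transpose (ρ : HomToTangent E F V)
    (a : Cₛ^∞⟮𝓘(ℝ, E); F, V⟯ × C^∞⟮𝓘(ℝ, E), M; ℝ⟯)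
    (p : DualBundle E (TangentSpace 𝓘(ℝ, E) : M → Type _)) :
    generatorFun a (ρ.transpose p) = generatorFun (ρ.map a.1, a.2) p := rfl

lemma HomToTangent.contMDiff_transpose (ρ : HomToTangent E F V) :
    ContMDiff (𝓘(ℝ, E).prod 𝓘(ℝ, E →L[ℝ] ℝ)) 𝓙 ∞ ρ.transpose := by
  intro p
  rw [contMDiffAt_hom_bundle]
  have hπ : ContMDiffAt (𝓘(ℝ, E).prod 𝓘(ℝ, E →L[ℝ] ℝ)) 𝓘(ℝ, E) ∞
      (π (E →L[ℝ] ℝ) fun x => TangentSpace 𝓘(ℝ, E) x →L[ℝ] ℝ) p := Bundle.contMDiffAt_proj _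
  refine ⟨hπ, ?_⟩
  have h1 := ((contMDiffAt_hom_bundle (n := ∞) _).1 (contMDiffAt_id (x := p)
    (I := 𝓘(ℝ, E).prod 𝓘(ℝ, E →L[ℝ] ℝ)))).2
  have h2 := ((contMDiffAt_hom_bundle (n := ∞) _).1 (ρ.contMDiff.contMDiffAt.comp p hπ)).2
  -- In trivializations the transpose is composition of the covector with the matrix of ρ. The
  -- trivialization of TM and its inverse, inserted in the middle, cancel on the base set.
  refine (h1.clm_comp h2).congr_of_eventuallyEq ?_
  filter_upwards [hπ.continuousAt.preimage_mem_nhds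
    ((trivializationAt E (TangentSpace 𝓘(ℝ, E)) p.1).open_baseSet.mem_nhds
      (FiberBundle.mem_baseSet_trivializationAt' p.1))] with q hq
  ext v
  simp only [ContinuousLinearMap.inCoordinates, ContinuousLinearMap.comp_apply]
  exact congrArg (fun w => Trivialization.continuousLinearMapAt ℝ
    (trivializationAt ℝ (fun _ : M => ℝ) p.1) q.1 (q.2 w))
    ((trivializationAt E (TangentSpace 𝓘(ℝ, E)) p.1).symmL_continuousLinearMapAt (R := ℝ) hq _).symm

/-- The transpose of the anchor of a Lie algebroid is a Poisson map. -/
theorem IsLieAlgebroid.isPushforward_transpose (h : IsLieAlgebroid ρ br)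
    {η : PoissonStructure (𝓘(ℝ, E).prod 𝓘(ℝ, E →L[ℝ] ℝ))
      (DualBundle E (TangentSpace 𝓘(ℝ, E) : M → Type _))}
    {ηV : PoissonStructure 𝓙 (DualBundle F V)} (hη : IsCanonicalPoisson η)
    (hηV : IsLinearPoisson ρ br ηV) : IsPushforward ρ.transpose η ηV := by
  intro p α β
  have hd (a : Cₛ^∞⟮𝓘(ℝ, E); F, V⟯ × C^∞⟮𝓘(ℝ, E), M; ℝ⟯) :=
    differential_comp (generatorFun a) (ρ.contMDiff_transpose.mdifferentiable (by simp) p)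
  rw [← differential_generatorLift _ α, ← differential_generatorLift _ β,
    hηV.bracket_generatorFun h, ← hd, ← hd]
  -- The covectors pulled back to T*M are differentials of the generators of (ρX, f), so the
  -- canonical bracket is computed by the semidirect product for TM. The anchor identity then
  -- matches the two sides.
  refine Eq.trans ?_ (IsLinearPoisson.bracket_generatorFun isLieAlgebroid_tangent hη
    (ρ.map (generatorLift _ α).1, (generatorLift _ α).2)
    (ρ.map (generatorLift _ β).1, (generatorLift _ β).2) p).symm
  rw [HomToTangent.generatorFun_transpose, h.generatorBracket_apply, h.anchor]
  rfl

end LinearPoisson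

end

theorem mainTheorem8 {E : Type*} [NormedAddCommGroup E] [NormedSpace ℝ E] [FiniteDimensional ℝ E]
    {M : Type*} [TopologicalSpace M] [T2Space M] [ChartedSpace E M] [IsManifold 𝓘(ℝ, E) ∞ M]
    (𝓕 : Foliation E M) (N : HomToTangent E 𝓕.model 𝓕.Tan) (hN : Foliation.IsPNO N) :
    IsLieAlgebroid N hN.bracket ∧
    (∃! η : PoissonStructure (𝓘(ℝ, E).prod 𝓘(ℝ, E →L[ℝ] ℝ))
      (DualBundle E (TangentSpace 𝓘(ℝ, E) : M → Type _)), IsCanonicalPoisson η) ∧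
    (∃! ηN : PoissonStructure (𝓘(ℝ, E).prod 𝓘(ℝ, 𝓕.model →L[ℝ] ℝ)) (DualBundle 𝓕.model 𝓕.Tan),
      IsLinearPoisson N hN.bracket ηN) ∧
    ContMDiff (𝓘(ℝ, E).prod 𝓘(ℝ, E →L[ℝ] ℝ)) (𝓘(ℝ, E).prod 𝓘(ℝ, 𝓕.model →L[ℝ] ℝ)) ∞ N.transpose ∧
    ∀ (η : PoissonStructure (𝓘(ℝ, E).prod 𝓘(ℝ, E →L[ℝ] ℝ))
        (DualBundle E (TangentSpace 𝓘(ℝ, E) : M → Type _)))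
      (ηN : PoissonStructure (𝓘(ℝ, E).prod 𝓘(ℝ, 𝓕.model →L[ℝ] ℝ)) (DualBundle 𝓕.model 𝓕.Tan)),
      IsCanonicalPoisson η → IsLinearPoisson N hN.bracket ηN →
      IsPushforward N.transpose η ηN := by
  exact ⟨hN.isLieAlgebroid, isLieAlgebroid_tangent.existsUnique_isLinearPoisson,
    hN.isLieAlgebroid.existsUnique_isLinearPoisson, N.contMDiff_transpose,
    fun _ _ hη hηN => hN.isLieAlgebroid.isPushforward_transpose hη hηN⟩
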